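/- Let $L$ be a locally compact group with neutral element $e_L$, and let $\mathcal P(L)$ be the set of continuous functions $g:L\to\mathbb C$ for which the kernel $(u,v)\mapsto g(u^{-1}v)$ is positive definite, where a kernel $k$ on a set $X$ is called positive definite if $\sum_{i,j}k(x_i,x_j)c_i\overline{c_j}\ge 0$ for all finite families of points $x_i\in X$ and numbers $c_i\in\mathbb C$. For $q\ge 2$ let $\Omega_{2q}$ be the unit sphere of $\mathbb C^q$ with scalar product $\xi\cdot\eta=\sum_k\xi_k\overline{\eta_k}$. Let $\mathbb D$ be the open unit disc in $\mathbb C$, and let $f:\overline{\mathbb D}\times L\to\mathbb C$ belong to $\mathcal P(\Omega_\infty,L)$, i.e. $f$ is continuous and the kernel $((\xi,u),(\eta,v))\mapsto f(\xi\cdot\eta,u^{-1}v)$ is positive definite on $\Omega_{2q}\times L$ for every $q\ge 2$. For $\alpha>-1$ and $m,n\in\mathbb N_0$ let $R^\alpha_{m,n}$ be the disc polynomial $$R^\alpha_{m,n}(re^{i\theta})=r^{|m-n|}e^{i(m-n)\theta}\,\frac{P^{(\alpha,|m-n|)}_{\min(m,n)}(2r^2-1)}{P^{(\alpha,|m-n|)}_{\min(m,n)}(1)},\qquad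 0\le r\le 1,\ \theta\in\mathbb R,$$ where $P^{(\alpha,\beta)}_k$ are the Jacobi polynomials. Then the following holds. (a) For every $q\ge 2$ there is exactly one double sequence $(\varphi^{q-2}_{m,n})_{m,n\ge0}$ in $\mathcal P(L)$ with $\sum_{m,n}\varphi^{q-2}_{m,n}(e_L)<\infty$ and $$f(z,u)=\sum_{m,n=0}^\infty\varphi^{q-2}_{m,n}(u)R^{q-2}_{m,n}(z),\qquad z\in\overline{\mathbb D},\ u\in L,$$ and there is exactly one double sequence $(\varphi_{m,n})_{m,n\ge0}$ in $\mathcal P(L)$ with $\sum_{m,n}\varphi_{m,n}(e_L)<\infty$ and $$f(z,u)=\sum_{m,n=0}^\infty\varphi_{m,n}(u)z^m\overline z^n,\qquad z\in\overline{\mathbb D},\ u\in L.$$ (b) For every $u\in L$ the function $f(\cdot,u)$ is $C^\infty$ on $\mathbb D$ (in the real sense), and for all $m,n\in\mathbb N_0$ $$\lim_{q\to\infty}\varphi^{q-2}_{m,n}(u)=\varphi_{m,n}(u)=\frac1{m!\,n!}\frac{\partial^{m+n}f(0,u)}{\partial z^m\partial\overline z^n},\qquad u\in L,$$ where the convergence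 is uniform for $u$ in compact subsets of $L$. -/

import Mathlib

open scoped ComplexOrder ContDiff ComplexConjugate

noncomputable section

namespace PDSphere

/-- A kernel `k : X × X → ℂ` is positive definite if all the finite sums
`∑ k(x_j, x_k) c_j conj(c_k)` are real and non-negative. -/
def IsPosDefKernel {X : Type*} (k : X → X → ℂ) : Prop :=
  ∀ (n : ℕ) (x : Fin n → X) (c : Fin n → ℂ),
    0 ≤ ∑ i, ∑ j, k (x i) (x j) * c i * conj (c j)

/-- The class `P(L)` of continuous positive definite functions on the group `L`. -/
def IsPosDefFun {L : Type*} [Group L] [TopologicalSpace L] (g : L → ℂ) : Prop :=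
  Continuous g ∧ IsPosDefKernel (fun u v : L => g (u⁻¹ * v))

/-- The complex unit sphere `Ω_{2q}` of `ℂ^q`. -/
abbrev ComplexSphere (q : ℕ) : Type :=
  Metric.sphere (0 : EuclideanSpace ℂ (Fin q)) 1

/-- The hermitian scalar product `ξ·η = ∑ ξ_k conj(η_k)`, linear in the first variable. -/
def sdot {q : ℕ} (ξ η : ComplexSphere q) : ℂ :=
  ∑ k : Fin q, (ξ : EuclideanSpace ℂ (Fin q)) k * conj ((η : EuclideanSpace ℂ (Fin q)) k)

/-- The class `P(Ω_{2q}, L)`. A function on (closed unit disc) `× L` is given by a function on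
`ℂ × L`, of which only the values over the closed unit disc are ever used. -/
def MemPSphere {L : Type*} [Group L] [TopologicalSpace L] (q : ℕ) (f : ℂ → L → ℂ) : Prop :=
  ContinuousOn (fun p : ℂ × L => f p.1 p.2) (Metric.closedBall (0 : ℂ) 1 ×ˢ Set.univ) ∧
  IsPosDefKernel (fun p p' : ComplexSphere q × L => f (sdot p.1 p'.1) (p.2⁻¹ * p'.2))

/-- The class `P(Ω_∞, L)`, the intersection of the classes `P(Ω_{2q}, L)` over `q ≥ 2`. -/
def MemPSphereInfty {L : Type*} [Group L] [TopologicalSpace L] (f : ℂ → L → ℂ) : Prop :=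
  ∀ q : ℕ, 2 ≤ q → MemPSphere q f

/-- The shifted factorial `(a)_k = a (a+1) ⋯ (a+k-1)`. -/
def poch (a : ℝ) (k : ℕ) : ℝ := (ascPochhammer ℝ k).eval a

/-- The Jacobi polynomial
`P_k^{(α,β)}(x) = ((α+1)_k / k!) ₂F₁(-k, k+α+β+1; α+1; (1-x)/2)`, for `α, β > -1`. -/
def jacobiP (α β : ℝ) (k : ℕ) (x : ℝ) : ℝ :=
  poch (α + 1) k / (k.factorial : ℝ) *
    ∑ s ∈ Finset.range (k + 1),
      poch (-(k : ℝ)) s * poch ((k : ℝ) + α + β + 1) s / (poch (α + 1) s * (s.factorial : ℝ)) *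
        ((1 - x) / 2) ^ s

/-- The normalized Jacobi polynomial `R_k^{(α,β)}(x) = P_k^{(α,β)}(x) / P_k^{(α,β)}(1)`. -/
def jacobiR (α β : ℝ) (k : ℕ) (x : ℝ) : ℝ := jacobiP α β k x / jacobiP α β k 1

/-- The disc polynomial `R_{m,n}^α`. Of the two truncated differences of natural numbers, one is
`|m - n|` and the other `0`, so that the first two factors are `r^|m-n| e^{i(m-n)θ}`
at `z = r e^{iθ}`; see `discPoly_polar`. -/
def discPoly (α : ℝ) (m n : ℕ) (z : ℂ) : ℂ :=
  z ^ (m - n) * (conj z) ^ (n - m) *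
    ((jacobiR α |(m : ℝ) - (n : ℝ)| (min m n) (2 * ‖z‖ ^ 2 - 1) : ℝ) : ℂ)

/-- The disc polynomials in polar coordinates. -/
theorem discPoly_polar (α : ℝ) (m n : ℕ) (r θ : ℝ) (hr : 0 ≤ r) :
    discPoly α m n ((r : ℂ) * Complex.exp (θ * Complex.I)) =
      (r : ℂ) ^ ((m : ℤ) - (n : ℤ)).natAbs *
        Complex.exp (((m : ℂ) - (n : ℂ)) * θ * Complex.I) *
        ((jacobiR α |(m : ℝ) - (n : ℝ)| (min m n) (2 * r ^ 2 - 1) : ℝ) : ℂ) := by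
  have hn : ‖(r : ℂ) * Complex.exp (θ * Complex.I)‖ = r := by
    rw [norm_mul, Complex.norm_exp_ofReal_mul_I, Complex.norm_real, Real.norm_eq_abs,
      abs_of_nonneg hr, mul_one]
  have hc : conj ((r : ℂ) * Complex.exp (θ * Complex.I)) =
      (r : ℂ) * Complex.exp (-(θ * Complex.I)) := by
    rw [map_mul, Complex.conj_ofReal, ← Complex.exp_conj]
    simp
  unfold discPoly
  rw [hn, hc]
  congr 1
  rcases le_total n m with h | h
  · obtain ⟨k, rfl⟩ := Nat.exists_eq_add_of_le h
    have h1 : n + k - n = k := by omega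
    have h2 : n - (n + k) = 0 := by omega
    have h3 : (((n + k : ℕ) : ℤ) - (n : ℤ)).natAbs = k := by omega
    rw [h1, h2, h3, mul_pow, ← Complex.exp_nat_mul, pow_zero, mul_one]
    push_cast
    ring_nf
  · obtain ⟨k, rfl⟩ := Nat.exists_eq_add_of_le h
    have h1 : m + k - m = k := by omega
    have h2 : m - (m + k) = 0 := by omega
    have h3 : ((m : ℤ) - ((m + k : ℕ) : ℤ)).natAbs = k := by omega
    have h4 : ((m : ℂ) - ((m + k : ℕ) : ℂ)) * θ * Complex.I = (k : ℂ) * -(θ * Complex.I) := by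
      push_cast
      ring
    rw [h1, h2, h3, h4, pow_zero, one_mul, mul_pow, Complex.exp_nat_mul]

/-- `φ` is a double sequence from `P(L)` with `∑ φ_{m,n}(e) < ∞` and
`f(z,u) = ∑ φ_{m,n}(u) R_{m,n}^{q-2}(z)` for all `|z| ≤ 1` and `u ∈ L`. -/
def IsDiscExpansion {L : Type*} [Group L] [TopologicalSpace L] (q : ℕ) (f : ℂ → L → ℂ)
    (φ : ℕ → ℕ → L → ℂ) : Prop :=
  (∀ m n, IsPosDefFun (φ m n)) ∧
  Summable (fun p : ℕ × ℕ => φ p.1 p.2 1) ∧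
  ∀ z ∈ Metric.closedBall (0 : ℂ) 1, ∀ u : L,
    HasSum (fun p : ℕ × ℕ => φ p.1 p.2 u * discPoly ((q : ℝ) - 2) p.1 p.2 z) (f z u)

/-- `φ` is a double sequence from `P(L)` with `∑ φ_{m,n}(e) < ∞` and
`f(z,u) = ∑ φ_{m,n}(u) z^m conj(z)^n` for all `|z| ≤ 1` and `u ∈ L`. -/
def IsPowerExpansion {L : Type*} [Group L] [TopologicalSpace L] (f : ℂ → L → ℂ)
    (φ : ℕ → ℕ → L → ℂ) : Prop :=
  (∀ m n, IsPosDefFun (φ m n)) ∧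
  Summable (fun p : ℕ × ℕ => φ p.1 p.2 1) ∧
  ∀ z ∈ Metric.closedBall (0 : ℂ) 1, ∀ u : L,
    HasSum (fun p : ℕ × ℕ => φ p.1 p.2 u * (z ^ p.1 * (conj z) ^ p.2)) (f z u)

/-- The operator `∂/∂z = (∂/∂x - i ∂/∂y) / 2`. -/
def dz (g : ℂ → ℂ) (z : ℂ) : ℂ :=
  (fderiv ℝ g z 1 - Complex.I * fderiv ℝ g z Complex.I) / 2

/-- The operator `∂/∂z̄ = (∂/∂x + i ∂/∂y) / 2`. -/
def dzbar (g : ℂ → ℂ) (z : ℂ) : ℂ :=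
  (fderiv ℝ g z 1 + Complex.I * fderiv ℝ g z Complex.I) / 2

end PDSphere

end

noncomputable section

namespace PDSphere

/-! ### Positive definite kernels and functions -/

/-! Everything is derived from the power expansion, whose existence comes from a probabilistic
approximation in the spirit of Bernstein. If `x_1, …, x_n` are roots of unity, the vector with
coordinates `x_j / √n` lies on the unit sphere of `ℂ^n`, and the scalar product of two such vectors
is the average of the quotients of their roots. So `f` induces a translation invariant positive
definite kernel on a finite torus times `L`, and its Fourier coefficients over the torus are
positive definite in `u` (`MemPSphere.isPosDefKernel_sum_addChar`). Now draw the roots independently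
from a Fejér–Poisson density with mean `(1 - 1/n) z`. The expectation of `f` at their average is a
polynomial in `z` and `conj z` whose coefficients are nonnegative combinations of those Fourier
coefficients (`approx_eq_sum`), and by the law of large numbers it tends to `f z u`
(`tendsto_approx`). The coefficients at the neutral element have bounded sums, so compactness yields
limiting coefficients (`exists_isPowerExpansion`).

The power series may be differentiated termwise in the open disc. Its derivatives at `0` give back
the coefficients, hence both smoothness and uniqueness (`IsPowerExpansion.eq_iterate`).

For fixed `q`, each `z^m conj(z)^n` is a convex combination of the disc polynomials of bidegree
`(m-i, n-i)`, because multiplication by `t` has a nonnegative matrix in the Jacobi basis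
(`wInt_X_mul_jacobiPoly_nonneg`). Substituting this into the power expansion expresses the
coefficient of bidegree `(m, n)` as a weighted sum of the `φ_{m+i,n+i}`; the rearrangement uses that
disc polynomials are bounded by `1` (`abs_pow_mul_jacobiPoly_le`). As `q → ∞` the weight with `i =
0`, the inverse of a leading coefficient, tends to `1`; the others tend to `0`, since the weights in
each monomial sum to `1`. Dominated convergence then gives the limit, uniformly on all of `L`.
Uniqueness for fixed `q` is orthogonality: Fourier analysis in the angle, Jacobi polynomials in the
radius. -/

theorem IsPosDefKernel.sum_nonneg {X : Type*} {k : X → X → ℂ} (hk : IsPosDefKernel k)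
    {ι : Type*} [Fintype ι] (x : ι → X) (c : ι → ℂ) :
    0 ≤ ∑ i, ∑ j, k (x i) (x j) * c i * conj (c j) := by
  have e := Fintype.equivFin ι
  have h := hk (Fintype.card ι) (x ∘ e.symm) (c ∘ e.symm)
  convert h using 1
  rw [← e.symm.sum_comp]
  refine Finset.sum_congr rfl fun i _ => ?_
  rw [← e.symm.sum_comp]
  rfl

theorem IsPosDefKernel.of_tendsto {X ι : Type*} {l : Filter ι} [l.NeBot] {F : ι → X → X → ℂ}
    {k : X → X → ℂ} (hF : ∀ i, IsPosDefKernel (F i))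
    (h : ∀ x y, Filter.Tendsto (fun i => F i x y) l (nhds (k x y))) : IsPosDefKernel k := by
  intro n x c
  refine ge_of_tendsto' (x := l) (f := fun t => ∑ i, ∑ j, F t (x i) (x j) * c i * conj (c j)) ?_
    fun t => hF t n x c
  refine tendsto_finsetSum _ fun i _ => tendsto_finsetSum _ fun j _ => ?_
  exact ((h _ _).mul_const _).mul_const _

theorem isPosDefKernel_sum {X ι : Type*} (s : Finset ι) {F : ι → X → X → ℂ}
    (hF : ∀ i ∈ s, IsPosDefKernel (F i)) : IsPosDefKernel (fun x y => ∑ i ∈ s, F i x y) := by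
  intro n x c
  have : ∑ i, ∑ j, (∑ t ∈ s, F t (x i) (x j)) * c i * conj (c j) =
      ∑ t ∈ s, ∑ i, ∑ j, F t (x i) (x j) * c i * conj (c j) := by
    simp only [Finset.sum_mul]
    conv_lhs => enter [2, i]; rw [Finset.sum_comm]
    rw [Finset.sum_comm]
  rw [this]
  exact Finset.sum_nonneg fun t ht => hF t ht n x c

theorem IsPosDefKernel.const_mul {X : Type*} {k : X → X → ℂ} (hk : IsPosDefKernel k) {a : ℂ}
    (ha : 0 ≤ a) : IsPosDefKernel (fun x y => a * k x y) := by
  intro n x c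
  have := mul_nonneg ha (hk n x c)
  simpa only [Finset.mul_sum, mul_assoc] using this

theorem isPosDefKernel_tsum {X ι : Type*} {F : ι → X → X → ℂ} (hF : ∀ i, IsPosDefKernel (F i))
    (hs : ∀ x y, Summable fun i => F i x y) : IsPosDefKernel (fun x y => ∑' i, F i x y) :=
  IsPosDefKernel.of_tendsto (l := Filter.atTop)
    (F := fun (s : Finset ι) x y => ∑ i ∈ s, F i x y)
    (fun s => isPosDefKernel_sum s fun i _ => hF i) fun x y => (hs x y).hasSum

/-! ### Inequalities for positive definite functions on a group -/

section Group

variable {L : Type*} [Group L]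

/-- The kernel `(u, v) ↦ g (u⁻¹ v)` attached to a function on a group. -/
abbrev groupKernel (g : L → ℂ) : L → L → ℂ := fun u v => g (u⁻¹ * v)

variable {g : L → ℂ}

theorem IsPosDefKernel.one_nonneg (hg : IsPosDefKernel (groupKernel g)) : 0 ≤ g 1 := by
  simpa [groupKernel] using hg 1 (fun _ => 1) (fun _ => 1)

theorem IsPosDefKernel.ofReal_re_one (hg : IsPosDefKernel (groupKernel g)) :
    (((g 1).re : ℝ) : ℂ) = g 1 := by
  have := hg.one_nonneg
  rw [Complex.nonneg_iff] at this
  apply Complex.ext <;> simp [this.2]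

theorem IsPosDefKernel.re_one_nonneg (hg : IsPosDefKernel (groupKernel g)) : 0 ≤ (g 1).re :=
  (Complex.nonneg_iff.1 hg.one_nonneg).1

theorem IsPosDefKernel.map_inv (hg : IsPosDefKernel (groupKernel g)) (u : L) :
    g u⁻¹ = conj (g u) := by
  have h0 := Complex.nonneg_iff.1 hg.one_nonneg
  have h1 := Complex.nonneg_iff.1 (hg 2 ![1, u] ![1, 1])
  have h2 := Complex.nonneg_iff.1 (hg 2 ![1, u] ![1, Complex.I])
  simp [Fin.sum_univ_two, groupKernel] at h1 h2
  have h3 := h1.2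
  have h4 := h2.2
  have h5 := h0.2
  apply Complex.ext <;> simp <;> linarith

/-- Cauchy–Schwarz by discriminants: along `l = t * conj Z` with `t` real the hypothesis is a real
quadratic in `t` without negative values. -/
theorem norm_sq_le_mul_of_forall {A D : ℝ} {Z : ℂ}
    (h : ∀ l : ℂ, 0 ≤ ‖l‖ ^ 2 * A + 2 * (l * Z).re + D) : ‖Z‖ ^ 2 ≤ A * D := by
  by_cases hZ : Z = 0
  · subst hZ
    have hD : 0 ≤ D := by simpa using h 0
    have hA : 0 ≤ A := by
      by_contra hA
      push Not at hA
      -- If `A < 0`, a large `l` makes the form negative: here `‖l‖ ^ 2 * (-A) ≥ D + 1`.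
      have := h ((D + 1 : ℝ) / (-A) + 1 : ℝ)
      simp only [mul_zero, Complex.zero_re, Complex.norm_real, Real.norm_eq_abs, sq_abs,
        add_zero] at this
      have h1 : (D + 1) / (-A) * (-A) = D + 1 := div_mul_cancel₀ _ (by linarith)
      have h2 : 0 ≤ (D + 1) / (-A) := div_nonneg (by linarith) (by linarith)
      nlinarith
    simpa using mul_nonneg hA hD
  · have hp : 0 < ‖Z‖ ^ 2 := by positivity
    have key : ∀ t : ℝ, 0 ≤ (‖Z‖ ^ 2 * A) * (t * t) + (2 * ‖Z‖ ^ 2) * t + D := by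
      intro t
      have := h (t * conj Z)
      rw [mul_assoc, mul_comm (conj Z), Complex.mul_conj, Complex.normSq_eq_norm_sq] at this
      simp only [norm_mul, Complex.norm_real, Real.norm_eq_abs, mul_pow, sq_abs,
        RCLike.norm_conj] at this
      rw [← Complex.ofReal_mul, Complex.ofReal_re] at this
      nlinarith
    have := discrim_le_zero key
    unfold discrim at this
    nlinarith

theorem IsPosDefKernel.norm_le (hg : IsPosDefKernel (groupKernel g)) (u : L) :
    ‖g u‖ ≤ (g 1).re := by
  have : ‖g u‖ ^ 2 ≤ (g 1).re * (g 1).re := by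
    refine norm_sq_le_mul_of_forall fun l => ?_
    have h1 := (Complex.nonneg_iff.1 (hg 2 ![1, u] ![l, 1])).1
    simp only [Fin.sum_univ_two, groupKernel, Matrix.cons_val_zero, Matrix.cons_val_one, inv_one,
      one_mul, inv_mul_cancel, mul_one, map_one, hg.map_inv u] at h1
    rw [← hg.ofReal_re_one, mul_assoc, Complex.mul_conj, Complex.normSq_eq_norm_sq] at h1
    simp [← Complex.ofReal_pow] at h1 ⊢
    nlinarith
  exact abs_le_of_sq_le_sq' (by nlinarith) hg.re_one_nonneg |>.2

/-- Krein's inequality: the quadratic form at the points `1, u, v` with coefficients `l, 1, -1`. It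
reduces continuity everywhere to continuity of the real part at the neutral element. -/
theorem IsPosDefKernel.norm_sub_sq_le (hg : IsPosDefKernel (groupKernel g)) (u v : L) :
    ‖g u - g v‖ ^ 2 ≤ (g 1).re * (2 * ((g 1).re - (g (u⁻¹ * v)).re)) := by
  refine norm_sq_le_mul_of_forall fun l => ?_
  have h1 := (Complex.nonneg_iff.1 (hg 3 ![1, u, v] ![l, 1, -1])).1
  have h2 : g (v⁻¹ * u) = conj (g (u⁻¹ * v)) := by rw [← hg.map_inv, mul_inv_rev, inv_inv]
  simp only [Fin.sum_univ_three, groupKernel, Matrix.cons_val_zero, Matrix.cons_val_one, inv_one,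
    one_mul, inv_mul_cancel, mul_one, map_one, hg.map_inv u, hg.map_inv v, Matrix.cons_val, h2]
    at h1
  rw [← hg.ofReal_re_one, mul_assoc, Complex.mul_conj, Complex.normSq_eq_norm_sq] at h1
  simp [← Complex.ofReal_pow] at h1 ⊢
  nlinarith

end Group

section TopGroup

variable {L : Type*} [Group L] [TopologicalSpace L] [IsTopologicalGroup L]

/-- A positive definite function whose oscillation at the neutral element is dominated by that of
a continuous function is continuous. -/
theorem IsPosDefKernel.continuous_of_re_sub_le {g h : L → ℂ}
    (hg : IsPosDefKernel (groupKernel g)) (hh : Continuous h)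
    (hgh : ∀ u, (g 1).re - (g u).re ≤ (h 1).re - (h u).re) : Continuous g := by
  rw [continuous_iff_continuousAt]
  intro u
  rw [ContinuousAt, tendsto_iff_norm_sub_tendsto_zero]
  have hlim : Filter.Tendsto (fun v => Real.sqrt ((g 1).re * (2 * ((h 1).re - (h (v⁻¹ * u)).re))))
      (nhds u) (nhds 0) := by
    have : Continuous fun v => Real.sqrt ((g 1).re * (2 * ((h 1).re - (h (v⁻¹ * u)).re))) := by
      have := Complex.continuous_re
      fun_prop
    convert this.tendsto u using 2
    simp
  refine squeeze_zero (fun _ => norm_nonneg _) (fun v => ?_) hlim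
  refine Real.le_sqrt_of_sq_le ((hg.norm_sub_sq_le v u).trans ?_)
  have := hg.re_one_nonneg
  have := hgh (v⁻¹ * u)
  gcongr

end TopGroup

/-! ### A law of large numbers on finite probability spaces -/

/-- Variances of independent centred variables add. Splitting off the first coordinate, the cross
term vanishes because `y` has mean zero. -/
theorem sum_prod_mul_norm_sum_sq {X : Type*} [Fintype X] {p : X → ℝ} (hp1 : ∑ x, p x = 1)
    {y : X → ℂ} (hy : ∑ x, (p x : ℂ) * y x = 0) (n : ℕ) :
    ∑ x : Fin n → X, (∏ j, p (x j)) * ‖∑ j, y (x j)‖ ^ 2 = n * ∑ x, p x * ‖y x‖ ^ 2 := by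
  induction n with
  | zero => simp
  | succ n ih =>
    rw [← (Fin.consEquiv fun _ : Fin (n + 1) => X).sum_comp, Fintype.sum_prod_type]
    have hW : ∑ x : Fin n → X, ∏ j, p (x j) = 1 := by
      rw [← Fintype.sum_pow, hp1, one_pow]
    have key : ∀ a b : ℂ, ‖a + b‖ ^ 2 = ‖a‖ ^ 2 + ‖b‖ ^ 2 + 2 * (a * conj b).re := by
      intro a b
      rw [← Complex.normSq_eq_norm_sq, Complex.normSq_add, Complex.normSq_eq_norm_sq,
        Complex.normSq_eq_norm_sq]
    simp only [Fin.consEquiv, Equiv.coe_fn_mk, Fin.prod_univ_succ, Fin.cons_zero, Fin.cons_succ,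
      Fin.sum_univ_succ, key]
    have hc : ∀ T : ℂ, ∑ a, p a * (y a * conj T).re = 0 := by
      intro T
      have := congrArg (fun w => (w * conj T).re) hy
      simp only [Finset.sum_mul, Complex.re_sum, zero_mul, Complex.zero_re] at this
      rw [← this]
      refine Finset.sum_congr rfl fun a _ => ?_
      rw [mul_assoc, Complex.re_ofReal_mul]
    calc _ = (∑ a, p a * ‖y a‖ ^ 2) * (∑ x : Fin n → X, ∏ j, p (x j)) +
          (∑ a, p a) * (∑ x : Fin n → X, (∏ j, p (x j)) * ‖∑ j, y (x j)‖ ^ 2) +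
          2 * ∑ x : Fin n → X, (∏ j, p (x j)) *
            ∑ a, p a * (y a * conj (∑ j, y (x j))).re := by
            have h3 : ∑ x : Fin n → X, (∏ j, p (x j)) * ∑ a, p a * (y a * conj (∑ j, y (x j))).re =
                ∑ a, ∑ x : Fin n → X,
                  (∏ j, p (x j)) * (p a * (y a * conj (∑ j, y (x j))).re) := by
              rw [Finset.sum_comm]
              simp only [Finset.mul_sum]
            rw [h3, Finset.sum_mul_sum, Finset.sum_mul_sum, Finset.mul_sum,
              ← Finset.sum_add_distrib, ← Finset.sum_add_distrib]
            refine Finset.sum_congr rfl fun a _ => ?_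
            rw [Finset.mul_sum, ← Finset.sum_add_distrib, ← Finset.sum_add_distrib]
            refine Finset.sum_congr rfl fun x _ => ?_
            ring
      _ = _ := by
            simp only [hc, hW, hp1, ih]
            push_cast
            simp
            ring

/-- Chebyshev's argument: within distance `δ` of `z` continuity of `g` suffices; farther away the
difference is at most `2 * C`, hence at most `2 * C / δ ^ 2` times the squared distance. -/
theorem tendsto_sum_mul_of_tendsto_sq {Ω : ℕ → Type*} [∀ n, Fintype (Ω n)] {W : ∀ n, Ω n → ℝ}
    {S : ∀ n, Ω n → ℂ} {B : Set ℂ} {g : ℂ → ℂ} {z : ℂ} (hz : z ∈ B) (hg : ContinuousOn g B)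
    {C : ℝ} (hC : ∀ w ∈ B, ‖g w‖ ≤ C) (hW : ∀ᶠ n in Filter.atTop, ∀ x, 0 ≤ W n x)
    (hW1 : ∀ᶠ n in Filter.atTop, ∑ x, W n x = 1) (hS : ∀ᶠ n in Filter.atTop, ∀ x, S n x ∈ B)
    (hlim : Filter.Tendsto (fun n => ∑ x, W n x * ‖S n x - z‖ ^ 2) Filter.atTop (nhds 0)) :
    Filter.Tendsto (fun n => ∑ x, (W n x : ℂ) * g (S n x)) Filter.atTop (nhds (g z)) := by
  rw [Metric.tendsto_atTop']
  intro ε hε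
  obtain ⟨δ, hδ, hgδ⟩ := Metric.continuousOn_iff.1 hg z hz (ε / 2) (half_pos hε)
  have hC0 : 0 ≤ C := (norm_nonneg _).trans (hC z hz)
  have hlim2 := (hlim.const_mul (2 * C / δ ^ 2)).eventually_lt_const
    (u := ε / 2) (by simpa using half_pos hε)
  have hall := hW.and (hW1.and (hS.and hlim2))
  obtain ⟨N, hN⟩ := Filter.eventually_atTop.1 hall
  refine ⟨N, fun n hn => ?_⟩
  obtain ⟨h0, h1, h2, h3⟩ := hN n hn.le
  have hsub : (∑ x, (W n x : ℂ) * g (S n x)) - g z = ∑ x, (W n x : ℂ) * (g (S n x) - g z) := by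
    simp only [mul_sub, Finset.sum_sub_distrib, ← Finset.sum_mul]
    rw [← Complex.ofReal_sum, h1]
    simp
  rw [dist_eq_norm, hsub]
  have hterm : ∀ x, ‖(W n x : ℂ) * (g (S n x) - g z)‖ ≤
      W n x * (ε / 2) + 2 * C / δ ^ 2 * (W n x * ‖S n x - z‖ ^ 2) := by
    intro x
    rw [norm_mul, Complex.norm_real, Real.norm_eq_abs, abs_of_nonneg (h0 x)]
    have : ‖g (S n x) - g z‖ ≤ ε / 2 + 2 * C / δ ^ 2 * ‖S n x - z‖ ^ 2 := by
      by_cases hd : dist (S n x) z < δ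
      · have := (hgδ _ (h2 x) hd).le
        rw [dist_eq_norm] at this
        have : 0 ≤ 2 * C / δ ^ 2 * ‖S n x - z‖ ^ 2 := by positivity
        linarith
      · rw [dist_eq_norm, not_lt] at hd
        have h5 : ‖g (S n x) - g z‖ ≤ 2 * C := by
          have := norm_sub_le (g (S n x)) (g z)
          linarith [hC _ (h2 x), hC _ hz]
        have h6 : 1 ≤ ‖S n x - z‖ ^ 2 / δ ^ 2 := by
          rw [one_le_div (by positivity)]
          gcongr
        have h7 : 2 * C / δ ^ 2 * ‖S n x - z‖ ^ 2 = 2 * C * (‖S n x - z‖ ^ 2 / δ ^ 2) := by ring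
        rw [h7]
        nlinarith
    calc _ ≤ W n x * (ε / 2 + 2 * C / δ ^ 2 * ‖S n x - z‖ ^ 2) := by
          gcongr
          exact h0 x
      _ = _ := by ring
  calc _ ≤ _ := norm_sum_le _ _
    _ ≤ _ := Finset.sum_le_sum fun x _ => hterm x
    _ = ε / 2 + 2 * C / δ ^ 2 * ∑ x, W n x * ‖S n x - z‖ ^ 2 := by
      rw [Finset.sum_add_distrib, ← Finset.sum_mul, h1, Finset.mul_sum, one_mul]
    _ < ε := by linarith

/-! ### A positive polynomial approximation of the Poisson kernel -/

/-- The Fejér mean of order `n` of the Poisson kernel, times `n`. -/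
def fejerPoisson (n : ℕ) (s : ℂ) : ℂ :=
  ∑ i ∈ Finset.range n, ∑ j ∈ Finset.range n, s ^ (i - j) * conj s ^ (j - i)

/-- A form in which positivity on the closed disc is visible. With `A = ∑ i < n, s ^ i`, both sides
grow by `1 + s * A + conj (s * A)` when `n` increases by one. -/
theorem fejerPoisson_eq (n : ℕ) (s : ℂ) :
    fejerPoisson n s = ((‖∑ i ∈ Finset.range n, s ^ i‖ ^ 2 +
      (1 - ‖s‖ ^ 2) * ∑ k ∈ Finset.range n, ‖∑ i ∈ Finset.range k, s ^ i‖ ^ 2 : ℝ) : ℂ) := by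
  induction n with
  | zero => simp [fejerPoisson]
  | succ n ih =>
    have hA : ∑ j ∈ Finset.range n, s ^ (n - j) = s * ∑ i ∈ Finset.range n, s ^ i := by
      rw [← Finset.sum_range_reflect, Finset.mul_sum]
      refine Finset.sum_congr rfl fun j hj => ?_
      rw [← pow_succ']
      congr 1
      have := Finset.mem_range.1 hj
      omega
    have h1 : ∑ j ∈ Finset.range n, s ^ (n - j) * conj s ^ (j - n) =
        s * ∑ i ∈ Finset.range n, s ^ i := by
      rw [← hA]
      refine Finset.sum_congr rfl fun j hj => ?_
      rw [Nat.sub_eq_zero_of_le (Finset.mem_range.1 hj).le, pow_zero, mul_one]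
    have h2 : ∑ i ∈ Finset.range n, s ^ (i - n) * conj s ^ (n - i) =
        conj (s * ∑ i ∈ Finset.range n, s ^ i) := by
      rw [← hA, map_sum]
      refine Finset.sum_congr rfl fun j hj => ?_
      rw [Nat.sub_eq_zero_of_le (Finset.mem_range.1 hj).le, pow_zero, one_mul, map_pow]
    have h3 : fejerPoisson (n + 1) s = fejerPoisson n s + conj (s * ∑ i ∈ Finset.range n, s ^ i) +
        s * ∑ i ∈ Finset.range n, s ^ i + 1 := by
      unfold fejerPoisson
      rw [Finset.sum_range_succ]
      conv_lhs => enter [1, 2, i]; rw [Finset.sum_range_succ]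
      rw [Finset.sum_add_distrib, h2, Finset.sum_range_succ, h1]
      simp
      ring
    have h4 : ∑ i ∈ Finset.range (n + 1), s ^ i = s * ∑ i ∈ Finset.range n, s ^ i + 1 := by
      rw [Finset.sum_range_succ', Finset.mul_sum]
      simp [pow_succ']
    rw [h3, ih, h4, Finset.sum_range_succ (fun k => ‖∑ i ∈ Finset.range k, s ^ i‖ ^ 2)]
    generalize ∑ i ∈ Finset.range n, s ^ i = A
    push_cast
    simp only [← Complex.conj_mul']
    simp only [map_add, map_mul, map_one]
    ring

theorem fejerPoisson_nonneg (n : ℕ) {s : ℂ} (hs : ‖s‖ ≤ 1) : 0 ≤ fejerPoisson n s := by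
  rw [fejerPoisson_eq]
  have : 0 ≤ 1 - ‖s‖ ^ 2 := by nlinarith [norm_nonneg s]
  have h := Finset.sum_nonneg (s := Finset.range n)
    (f := fun k => ‖∑ i ∈ Finset.range k, s ^ i‖ ^ 2) fun k _ => by positivity
  exact_mod_cast add_nonneg (by positivity) (mul_nonneg this h)

/-! ### Fourier coefficients on finite tori embedded in the sphere -/

section Torus

variable {n M : ℕ} [NeZero n] [NeZero M]

/-- The average of `n` roots of unity. -/
def rootAvg (x : Fin n → ZMod M) : ℂ := (∑ j, ZMod.stdAddChar (x j)) / n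

theorem norm_stdAddChar (x : ZMod M) : ‖(ZMod.stdAddChar x : ℂ)‖ = 1 := AddChar.norm_apply _ _

theorem norm_rootAvg_le (x : Fin n → ZMod M) : ‖rootAvg x‖ ≤ 1 := by
  have hn : (0 : ℝ) < n := by exact_mod_cast NeZero.pos n
  rw [rootAvg, norm_div, Complex.norm_natCast, div_le_one hn]
  refine (norm_sum_le _ _).trans ?_
  simp

/-- The point of the unit sphere whose coordinates are multiples of roots of unity. -/
def rootVec (x : Fin n → ZMod M) : ComplexSphere n :=
  ⟨WithLp.toLp 2 fun j => ZMod.stdAddChar (x j) / (Real.sqrt n : ℂ), by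
    have hn : (0 : ℝ) < n := by exact_mod_cast NeZero.pos n
    rw [mem_sphere_zero_iff_norm, EuclideanSpace.norm_eq, Real.sqrt_eq_one]
    simp only [norm_div, norm_stdAddChar, Complex.norm_real, Real.norm_eq_abs, div_pow, one_pow,
      sq_abs, Real.sq_sqrt hn.le, Finset.sum_const, Finset.card_univ, Fintype.card_fin,
      nsmul_eq_mul]
    field_simp⟩

/-- Because only the difference `x - y` enters, the spherical kernel becomes a convolution kernel on
a finite abelian group, where characters are available. -/
theorem sdot_rootVec (x y : Fin n → ZMod M) :
    sdot (rootVec x) (rootVec y) = rootAvg (x - y) := by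
  have hn : (0 : ℝ) < n := by exact_mod_cast NeZero.pos n
  unfold sdot rootVec rootAvg
  rw [Finset.sum_div]
  refine Finset.sum_congr rfl fun j _ => ?_
  have h2 : (Real.sqrt n : ℂ) * (Real.sqrt n : ℂ) = n := by
    rw [← Complex.ofReal_mul, Real.mul_self_sqrt hn.le]
    simp
  simp only [map_div₀, Complex.conj_ofReal, Pi.sub_apply, sub_eq_add_neg, AddChar.map_add_eq_mul,
    AddChar.map_neg_eq_conj]
  rw [div_mul_div_comm, h2]

variable {L : Type*} [Group L] [TopologicalSpace L] {f : ℂ → L → ℂ}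

/-- Positive definiteness is tested on all pairs of a torus point `x` and one of the given group
elements, with coefficients `c i * χ x`. By translation invariance the sum over two torus points is
the cardinality of the torus times the sum over one. -/
theorem MemPSphere.isPosDefKernel_sum_addChar (hf : MemPSphere n f)
    (χ : AddChar (Fin n → ZMod M) ℂ) :
    IsPosDefKernel (groupKernel fun u => ∑ x : Fin n → ZMod M, f (rootAvg x) u * χ x) := by
  intro N u c
  have h := hf.2.sum_nonneg (ι := Fin N × (Fin n → ZMod M)) (fun p => (rootVec p.2, u p.1))
    (fun p => c p.1 * χ p.2)
  have hcard : (Fintype.card (Fin n → ZMod M) : ℂ) ≠ 0 := by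
    exact_mod_cast Fintype.card_ne_zero
  have hc0 : (0 : ℂ) ≤ (Fintype.card (Fin n → ZMod M) : ℂ)⁻¹ := by positivity
  refine (mul_nonneg hc0 h).trans_eq ?_
  rw [inv_mul_eq_iff_eq_mul₀ hcard]
  simp only [Fintype.sum_prod_type, sdot_rootVec]
  rw [Finset.mul_sum]
  refine Finset.sum_congr rfl fun i _ => ?_
  rw [Finset.sum_comm, Finset.mul_sum]
  refine Finset.sum_congr rfl fun j _ => ?_
  rw [Finset.sum_comm]
  have hy : ∀ y : Fin n → ZMod M, ∑ x, f (rootAvg (x - y)) ((u i)⁻¹ * u j) * (c i * χ x) *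
      conj (c j * χ y) = (∑ x, f (rootAvg x) ((u i)⁻¹ * u j) * χ x) * c i * conj (c j) := by
    intro y
    rw [← Equiv.sum_comp (Equiv.addRight y), Finset.sum_mul, Finset.sum_mul]
    refine Finset.sum_congr rfl fun x _ => ?_
    have h1 : χ y * conj (χ y) = 1 := by
      rw [Complex.mul_conj, Complex.normSq_eq_norm_sq, AddChar.norm_apply]
      simp
    simp only [Equiv.coe_addRight, add_sub_cancel_right, AddChar.map_add_eq_mul, map_mul]
    linear_combination (f (rootAvg x) ((u i)⁻¹ * u j) * χ x * c i * conj (c j)) * h1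
  simp only [hy, Finset.sum_const, Finset.card_univ, nsmul_eq_mul]

/-- The character with exponents `k` of a finite torus. -/
def torusChar (k : Fin n → ZMod M) : AddChar (Fin n → ZMod M) ℂ where
  toFun x := ∏ j, ZMod.stdAddChar (k j * x j)
  map_zero_eq_one' := by simp
  map_add_eq_mul' x y := by simp [mul_add, AddChar.map_add_eq_mul, Finset.prod_mul_distrib]

/-- A probability density on the roots of unity with mean close to `z`. -/
def rootWeight (n : ℕ) (z : ℂ) (x : ZMod M) : ℂ :=
  fejerPoisson n (z * conj (ZMod.stdAddChar x)) / (n * M)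

theorem rootWeight_nonneg {n M : ℕ} [NeZero M] {z : ℂ} (hz : ‖z‖ ≤ 1) (x : ZMod M) : 0 ≤ rootWeight n z x := by
  refine div_nonneg (fejerPoisson_nonneg n ?_) (by positivity)
  rw [norm_mul, RCLike.norm_conj, norm_stdAddChar, mul_one]
  exact hz

theorem fejerPoisson_mul_conj {n M : ℕ} [NeZero M] (z : ℂ) (x : ZMod M) :
    fejerPoisson n (z * conj (ZMod.stdAddChar x)) =
      ∑ k : Fin n × Fin n, z ^ ((k.1 : ℕ) - k.2) * conj z ^ ((k.2 : ℕ) - k.1) *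
        ZMod.stdAddChar (((k.2 : ℕ) - (k.1 : ℕ) : ZMod M) * x) := by
  have hpow : ∀ (a : ℕ) (y : ZMod M), (ZMod.stdAddChar y : ℂ) ^ a =
      ZMod.stdAddChar ((a : ZMod M) * y) := by
    intro a y
    rw [← AddChar.map_nsmul_eq_pow, nsmul_eq_mul]
  unfold fejerPoisson
  rw [Fintype.sum_prod_type, Finset.sum_range]
  refine Finset.sum_congr rfl fun i _ => ?_
  rw [Finset.sum_range]
  refine Finset.sum_congr rfl fun j _ => ?_
  rw [map_mul, Complex.conj_conj, mul_pow, mul_pow, ← AddChar.map_neg_eq_conj, hpow, hpow]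
  rw [mul_mul_mul_comm, ← AddChar.map_add_eq_mul]
  congr 2
  rcases le_total (i : ℕ) j with h | h
  · rw [Nat.sub_eq_zero_of_le h, Nat.cast_sub h]
    simp
  · rw [Nat.sub_eq_zero_of_le h, Nat.cast_sub h]
    simp
    ring

/-- Orthogonality of characters leaves the index pairs with `i = j + l`, of which there are `n - l`;
the condition `n + l ≤ M` excludes coincidences modulo `M`. The case `l = 0` gives total mass one,
the case `l = 1` the mean `(n - 1) / n * z`. -/
theorem sum_stdAddChar_mul_rootWeight (z : ℂ) (l : ℕ) (hM : n + l ≤ M) :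
    ∑ x : ZMod M, rootWeight n z x * ZMod.stdAddChar ((l : ZMod M) * x) =
      ((n - l : ℕ) : ℂ) / n * z ^ l := by
  have hn : (n : ℂ) ≠ 0 := NeZero.ne _
  have hM0 : (M : ℂ) ≠ 0 := NeZero.ne _
  have hstep : ∑ x : ZMod M, rootWeight n z x * ZMod.stdAddChar ((l : ZMod M) * x) =
      (∑ k : Fin n × Fin n, z ^ ((k.1 : ℕ) - k.2) * conj z ^ ((k.2 : ℕ) - k.1) *
        ∑ x : ZMod M, ZMod.stdAddChar (x * ((k.2 : ℕ) - (k.1 : ℕ) + l : ZMod M))) / (n * M) := by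
    simp only [rootWeight, fejerPoisson_mul_conj, Finset.mul_sum]
    rw [Finset.sum_comm, Finset.sum_div]
    refine Finset.sum_congr rfl fun x _ => ?_
    rw [div_mul_eq_mul_div, Finset.sum_mul]
    congr 1
    refine Finset.sum_congr rfl fun k _ => ?_
    rw [mul_assoc _ (ZMod.stdAddChar _), ← AddChar.map_add_eq_mul]
    ring_nf
  rw [hstep]
  simp only [AddChar.sum_mulShift _ (ZMod.isPrimitive_stdAddChar M)]
  have hiff : ∀ i j : Fin n, (((j : ℕ) - (i : ℕ) + l : ZMod M) = 0) ↔
      (i : ℕ) = j + l := by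
    intro i j
    have h1 := i.isLt
    have h2 := j.isLt
    constructor
    · intro h
      have h3 : (((j : ℕ) + l : ℕ) : ZMod M) = ((i : ℕ) : ZMod M) := by
        push_cast
        linear_combination h
      rw [ZMod.natCast_eq_natCast_iff', Nat.mod_eq_of_lt (by omega),
        Nat.mod_eq_of_lt (by omega)] at h3
      exact h3.symm
    · intro h
      rw [h]
      push_cast
      ring
  have hsum : ∑ k : Fin n × Fin n, z ^ ((k.1 : ℕ) - k.2) * conj z ^ ((k.2 : ℕ) - k.1) *
      (((if ((k.2 : ℕ) - (k.1 : ℕ) + l : ZMod M) = 0 then Fintype.card (ZMod M) else 0 : ℕ)) : ℂ) =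
      ((n - l : ℕ) : ℂ) * (z ^ l * M) := by
    rw [Fintype.sum_prod_type, Finset.sum_comm]
    simp only [hiff, ZMod.card]
    have : ∀ j : Fin n, ∑ i : Fin n, z ^ ((i : ℕ) - j) * conj z ^ ((j : ℕ) - i) *
        (((if (i : ℕ) = j + l then M else 0 : ℕ)) : ℂ) =
        if (j : ℕ) < n - l then z ^ l * M else 0 := by
      intro j
      split_ifs with hj
      · have hjl : (j : ℕ) + l < n := by omega
        rw [Finset.sum_eq_single ⟨j + l, hjl⟩]
        · simp
        · intro b _ hb
          rw [if_neg]
          · simp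
          · intro h
            exact hb (Fin.ext h)
        · simp
      · refine Finset.sum_eq_zero fun i _ => ?_
        rw [if_neg]
        · simp
        · have := i.isLt
          omega
    rw [Finset.sum_congr rfl fun j _ => this j, Finset.sum_ite, Finset.sum_const_zero, add_zero,
      Finset.sum_const, nsmul_eq_mul]
    congr 2
    have := Fin.card_filter_val_lt (m := n - l) (n := n)
    rw [this]
    omega
  rw [hsum]
  field_simp

end Torus

/-! ### Polynomial approximation by expectations over random roots of unity -/

section Approx

variable {n M : ℕ} [NeZero n] [NeZero M] {L : Type*} {f : ℂ → L → ℂ}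

/-- The monomial exponents attached to a choice of one term in each factor. -/
def termExp (κ : Fin n → Fin n × Fin n) : ℕ × ℕ :=
  (∑ j, ((κ j).1 - (κ j).2 : ℕ), ∑ j, ((κ j).2 - (κ j).1 : ℕ))

/-- The Fourier coefficient attached to a choice of one term in each factor. -/
def termCoeff (M : ℕ) [NeZero M] (f : ℂ → L → ℂ) (κ : Fin n → Fin n × Fin n) (u : L) : ℂ :=
  ((n * M : ℂ) ^ n)⁻¹ * ∑ x : Fin n → ZMod M, f (rootAvg x) u *
    torusChar (fun j => (((κ j).2 : ℕ) - ((κ j).1 : ℕ) : ZMod M)) x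

/-- The coefficient of `z ^ a * conj z ^ b` in the polynomial approximation of `f`. -/
def approxCoeff (n M : ℕ) [NeZero n] [NeZero M] (f : ℂ → L → ℂ) (p : ℕ × ℕ) (u : L) : ℂ :=
  ∑ κ : Fin n → Fin n × Fin n, if p = termExp κ then termCoeff M f κ u else 0

/-- The polynomial approximation of `f`: the expectation of `f` at the average of `n` independent
random roots of unity. -/
def approx (n M : ℕ) [NeZero n] [NeZero M] (f : ℂ → L → ℂ) (z : ℂ) (u : L) : ℂ :=
  ∑ x : Fin n → ZMod M, (∏ j, rootWeight n z (x j)) * f (rootAvg x) u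

/-- The product of the `n` densities is multiplied out. Each choice of one term per factor
contributes a monomial in `z` and `conj z` times a character of the torus, and summing that
character against `f` is a Fourier coefficient. -/
theorem approx_eq_sum (z : ℂ) (u : L) :
    approx n M f z u = ∑ κ : Fin n → Fin n × Fin n,
      termCoeff M f κ u * (z ^ (termExp κ).1 * conj z ^ (termExp κ).2) := by
  unfold approx termCoeff termExp
  have hprod : ∀ x : Fin n → ZMod M, ∏ j, rootWeight n z (x j) = ((n * M : ℂ) ^ n)⁻¹ *
      ∑ κ : Fin n → Fin n × Fin n, (z ^ (∑ j, ((κ j).1 - (κ j).2 : ℕ)) *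
        conj z ^ (∑ j, ((κ j).2 - (κ j).1 : ℕ))) *
        torusChar (fun j => (((κ j).2 : ℕ) - ((κ j).1 : ℕ) : ZMod M)) x := by
    intro x
    simp only [rootWeight, fejerPoisson_mul_conj, Finset.prod_div_distrib, Finset.prod_const,
      Finset.card_univ, Fintype.card_fin, Fintype.prod_sum]
    rw [div_eq_inv_mul]
    congr 1
    refine Finset.sum_congr rfl fun κ _ => ?_
    rw [Finset.prod_mul_distrib, Finset.prod_mul_distrib, Finset.prod_pow_eq_pow_sum,
      Finset.prod_pow_eq_pow_sum]
    rfl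
  simp only [hprod]
  simp only [Finset.mul_sum, Finset.sum_mul]
  rw [Finset.sum_comm]
  refine Finset.sum_congr rfl fun κ _ => Finset.sum_congr rfl fun x _ => ?_
  ring

theorem hasSum_approxCoeff (z : ℂ) (u : L) :
    HasSum (fun p : ℕ × ℕ => approxCoeff n M f p u * (z ^ p.1 * conj z ^ p.2))
      (approx n M f z u) := by
  rw [approx_eq_sum]
  simp only [approxCoeff, Finset.sum_mul]
  refine hasSum_sum fun κ _ => ?_
  have := hasSum_ite_eq (termExp κ)
    (termCoeff M f κ u * (z ^ (termExp κ).1 * conj z ^ (termExp κ).2))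
  refine this.congr_fun ?_
  intro p
  split_ifs with h
  · rw [h]
  · simp

theorem sum_prod_rootWeight (z : ℂ) (hM : n ≤ M) :
    ∑ x : Fin n → ZMod M, ∏ j, rootWeight n z (x j) = 1 := by
  have h := sum_stdAddChar_mul_rootWeight (n := n) (M := M) z 0 (by omega)
  have hn : (n : ℂ) ≠ 0 := NeZero.ne _
  simp only [Nat.cast_zero, zero_mul, AddChar.map_zero_eq_one, mul_one, Nat.sub_zero, pow_zero,
    div_self hn] at h
  rw [← Fintype.sum_pow, h, one_pow]

/-- The mean `μ` is within `1 / n` of `z`, and each variable is within `3` of `μ`, so its variance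
is at most `9`. Splitting the error into fluctuation and bias gives `2 * 9 / n + 2 / n ^ 2 ≤ 20 /
n`. -/
theorem sum_prod_rootWeight_mul_norm_sq_le {z : ℂ} (hz : ‖z‖ ≤ 1) (hM : n + 1 ≤ M) :
    ∑ x : Fin n → ZMod M, (∏ j, (rootWeight n z (x j)).re) * ‖rootAvg x - z‖ ^ 2 ≤ 20 / n := by
  have hn : (0 : ℝ) < n := by exact_mod_cast NeZero.pos n
  have hn1 : (1 : ℝ) ≤ n := by exact_mod_cast NeZero.pos n
  have hre : ∀ x : ZMod M, (((rootWeight n z x).re : ℝ) : ℂ) = rootWeight n z x := by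
    intro x
    have := Complex.nonneg_iff.1 (rootWeight_nonneg (n := n) hz x)
    apply Complex.ext <;> simp [this.2]
  have hnn : ∀ x : ZMod M, 0 ≤ (rootWeight n z x).re := fun x =>
    (Complex.nonneg_iff.1 (rootWeight_nonneg (n := n) hz x)).1
  have h0 := sum_stdAddChar_mul_rootWeight (n := n) (M := M) z 0 (by omega)
  have h1 := sum_stdAddChar_mul_rootWeight (n := n) (M := M) z 1 (by omega)
  have hn' : (n : ℂ) ≠ 0 := NeZero.ne _
  simp only [Nat.cast_zero, zero_mul, AddChar.map_zero_eq_one, mul_one, Nat.sub_zero, pow_zero,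
    div_self hn'] at h0
  simp only [Nat.cast_one, one_mul, pow_one] at h1
  rw [Nat.cast_sub NeZero.one_le] at h1
  set μ : ℂ := ((n : ℂ) - (1 : ℕ)) / n * z with hμ
  have hμz : ‖μ - z‖ ≤ 1 / n := by
    have : μ - z = -(z / n) := by
      rw [hμ]
      field_simp
      push_cast
      ring
    rw [this, norm_neg, norm_div, Complex.norm_natCast]
    gcongr
  have hp1 : ∑ x : ZMod M, (rootWeight n z x).re = 1 := by
    have := congrArg Complex.re h0
    simpa using this
  have hy : ∑ x : ZMod M, (((rootWeight n z x).re : ℝ) : ℂ) * (ZMod.stdAddChar x - μ) = 0 := by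
    simp only [hre, mul_sub, Finset.sum_sub_distrib, ← Finset.sum_mul, h0, h1]
    ring
  have hvar := sum_prod_mul_norm_sum_sq hp1 hy n
  have hμ1 : ‖μ‖ ≤ 2 := by
    have h2 : ‖μ‖ ≤ ‖μ - z‖ + ‖z‖ := by simpa using norm_add_le (μ - z) z
    have h3 : (1 : ℝ) / n ≤ 1 := by rw [div_le_one hn]; exact hn1
    linarith
  have hvar1 : ∑ x : ZMod M, (rootWeight n z x).re * ‖ZMod.stdAddChar x - μ‖ ^ 2 ≤ 9 := by
    calc _ ≤ ∑ x : ZMod M, (rootWeight n z x).re * 3 ^ 2 := by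
          refine Finset.sum_le_sum fun x _ => ?_
          have h3 := hnn x
          have h4 : ‖ZMod.stdAddChar x - μ‖ ≤ 3 := by
            have := norm_sub_le (ZMod.stdAddChar x : ℂ) μ
            rw [norm_stdAddChar] at this
            linarith
          gcongr
      _ = 9 := by rw [← Finset.sum_mul, hp1]; norm_num
  have hW0 : ∀ x : Fin n → ZMod M, 0 ≤ ∏ j, (rootWeight n z (x j)).re := fun x =>
    Finset.prod_nonneg fun j _ => hnn _
  have hW1 : ∑ x : Fin n → ZMod M, ∏ j, (rootWeight n z (x j)).re = 1 := by
    rw [← Fintype.sum_pow (fun x : ZMod M => (rootWeight n z x).re) n, hp1, one_pow]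
  have hpt : ∀ x : Fin n → ZMod M, ‖rootAvg x - z‖ ^ 2 ≤
      2 / n ^ 2 * ‖∑ j, (ZMod.stdAddChar (x j) - μ)‖ ^ 2 + 2 * (1 / n) ^ 2 := by
    intro x
    have h2 : rootAvg x - z = (∑ j, (ZMod.stdAddChar (x j) - μ)) / n + (μ - z) := by
      rw [rootAvg, Finset.sum_sub_distrib, Finset.sum_const, Finset.card_univ, Fintype.card_fin,
        nsmul_eq_mul]
      field_simp
      ring
    have h3 := norm_add_le ((∑ j, (ZMod.stdAddChar (x j) - μ)) / (n : ℂ)) (μ - z)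
    rw [← h2, norm_div, Complex.norm_natCast] at h3
    have h4 : ‖rootAvg x - z‖ ≤ ‖∑ j, (ZMod.stdAddChar (x j) - μ)‖ / n + 1 / n := by linarith
    calc _ ≤ (‖∑ j, (ZMod.stdAddChar (x j) - μ)‖ / n + 1 / n) ^ 2 := by gcongr
      _ ≤ 2 * (‖∑ j, (ZMod.stdAddChar (x j) - μ)‖ / n) ^ 2 + 2 * (1 / n) ^ 2 := by
        nlinarith [sq_nonneg (‖∑ j, (ZMod.stdAddChar (x j) - μ)‖ / n - 1 / n)]
      _ = _ := by ring
  calc _ ≤ ∑ x : Fin n → ZMod M, (∏ j, (rootWeight n z (x j)).re) *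
        (2 / n ^ 2 * ‖∑ j, (ZMod.stdAddChar (x j) - μ)‖ ^ 2 + 2 * (1 / n) ^ 2) :=
        Finset.sum_le_sum fun x _ => mul_le_mul_of_nonneg_left (hpt x) (hW0 x)
    _ = 2 / n ^ 2 * ∑ x : Fin n → ZMod M, (∏ j, (rootWeight n z (x j)).re) *
          ‖∑ j, (ZMod.stdAddChar (x j) - μ)‖ ^ 2 + 2 * (1 / n) ^ 2 := by
        simp only [mul_add, Finset.sum_add_distrib, ← Finset.sum_mul, hW1, one_mul]
        rw [Finset.mul_sum]
        congr 1
        exact Finset.sum_congr rfl fun x _ => by ring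
    _ ≤ 2 / n ^ 2 * (n * 9) + 2 * (1 / n) ^ 2 := by
        rw [hvar]
        gcongr
    _ ≤ 20 / n := by
        have : 2 * (1 / (n : ℝ)) ^ 2 ≤ 2 / n := by
          rw [one_div, div_eq_mul_inv, sq]
          have h5 : (n : ℝ)⁻¹ ≤ 1 := inv_le_one_of_one_le₀ hn1
          have h6 : 0 < (n : ℝ)⁻¹ := by positivity
          nlinarith
        have h7 : 2 / (n : ℝ) ^ 2 * (n * 9) = 18 / n := by field_simp; norm_num
        rw [h7]
        calc _ ≤ 18 / (n : ℝ) + 2 / n := by linarith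
          _ = 20 / n := by ring

end Approx

/-! ### Existence of the power expansion -/

section Existence

variable {L : Type*} {f : ℂ → L → ℂ}

theorem prod_rootWeight_re {n M : ℕ} [NeZero n] [NeZero M] {z : ℂ} (hz : ‖z‖ ≤ 1)
    (x : Fin n → ZMod M) :
    ((∏ j, (rootWeight n z (x j)).re : ℝ) : ℂ) = ∏ j, rootWeight n z (x j) := by
  rw [Complex.ofReal_prod]
  refine Finset.prod_congr rfl fun j _ => ?_
  have := Complex.nonneg_iff.1 (rootWeight_nonneg (n := n) hz (x j))
  apply Complex.ext <;> simp [this.2]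

theorem prod_rootWeight_re_nonneg {n M : ℕ} [NeZero n] [NeZero M] {z : ℂ} (hz : ‖z‖ ≤ 1)
    (x : Fin n → ZMod M) : 0 ≤ ∏ j, (rootWeight n z (x j)).re :=
  Finset.prod_nonneg fun j _ => (Complex.nonneg_iff.1 (rootWeight_nonneg (n := n) hz (x j))).1

theorem sum_prod_rootWeight_re {n M : ℕ} [NeZero n] [NeZero M] {z : ℂ} (hz : ‖z‖ ≤ 1)
    (hM : n ≤ M) : ∑ x : Fin n → ZMod M, ∏ j, (rootWeight n z (x j)).re = 1 := by
  have h := sum_prod_rootWeight (n := n) (M := M) z hM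
  simp only [← prod_rootWeight_re hz] at h
  exact_mod_cast h

theorem norm_approx_le {n M : ℕ} [NeZero n] [NeZero M] {z : ℂ} (hz : ‖z‖ ≤ 1) (hM : n ≤ M)
    {u : L} {C : ℝ} (hC : ∀ w ∈ Metric.closedBall (0 : ℂ) 1, ‖f w u‖ ≤ C) :
    ‖approx n M f z u‖ ≤ C := by
  unfold approx
  calc _ ≤ ∑ x : Fin n → ZMod M, (∏ j, (rootWeight n z (x j)).re) * C := by
        refine (norm_sum_le _ _).trans (Finset.sum_le_sum fun x _ => ?_)
        rw [norm_mul, ← prod_rootWeight_re hz, Complex.norm_real, Real.norm_eq_abs,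
          abs_of_nonneg (prod_rootWeight_re_nonneg hz x)]
        exact mul_le_mul_of_nonneg_left (hC _ (by simpa using norm_rootAvg_le x))
          (prod_rootWeight_re_nonneg hz x)
    _ = C := by rw [← Finset.sum_mul, sum_prod_rootWeight_re hz hM, one_mul]

/-- The order is `n + 2` because positive definiteness is available on `Ω_{2q}` for `q ≥ 2`; the
modulus exceeds it by one, as the first moment requires. -/
theorem tendsto_approx {u : L} (hf : ContinuousOn (fun z => f z u) (Metric.closedBall 0 1))
    {z : ℂ} (hz : ‖z‖ ≤ 1) :
    Filter.Tendsto (fun n => approx (n + 2) (n + 3) f z u) Filter.atTop (nhds (f z u)) := by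
  obtain ⟨C, hC⟩ := (isCompact_closedBall (0 : ℂ) 1).exists_bound_of_continuousOn hf
  have := tendsto_sum_mul_of_tendsto_sq (Ω := fun n => Fin (n + 2) → ZMod (n + 3))
    (W := fun n x => ∏ j, (rootWeight (n + 2) z (x j)).re) (S := fun n x => rootAvg x)
    (B := Metric.closedBall 0 1) (z := z) (by simpa using hz) hf hC
    (.of_forall fun n x => prod_rootWeight_re_nonneg hz x)
    (.of_forall fun n => sum_prod_rootWeight_re hz (by omega))
    (.of_forall fun n x => by simpa using norm_rootAvg_le x) ?_
  · simpa only [prod_rootWeight_re hz, approx] using this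
  · refine squeeze_zero (fun n => Finset.sum_nonneg fun x _ =>
      mul_nonneg (prod_rootWeight_re_nonneg hz x) (by positivity))
      (fun n => sum_prod_rootWeight_mul_norm_sq_le hz (by omega)) ?_
    exact (tendsto_const_div_atTop_nhds_zero_nat (20 : ℝ)).comp (Filter.tendsto_add_atTop_nat 2)

/-- Absolutely summable coefficients make the series uniformly convergent on the closed disc, so its
sum is continuous there and agreement with `g` passes to the closure of the open disc. -/
theorem hasSum_monomials_of_approx {g : ℂ → ℂ} (hg : ContinuousOn g (Metric.closedBall 0 1))
    {a : ℕ × ℕ → ℂ} (ha : Summable fun p => ‖a p‖)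
    (h : ∀ z : ℂ, ‖z‖ < 1 → HasSum (fun p => a p * (z ^ p.1 * conj z ^ p.2)) (g z)) {z : ℂ}
    (hz : ‖z‖ ≤ 1) : HasSum (fun p => a p * (z ^ p.1 * conj z ^ p.2)) (g z) := by
  have hb : ∀ p, ∀ w ∈ Metric.closedBall (0 : ℂ) 1, ‖a p * (w ^ p.1 * conj w ^ p.2)‖ ≤ ‖a p‖ := by
    intro p w hw
    rw [mem_closedBall_zero_iff] at hw
    rw [norm_mul, norm_mul, norm_pow, norm_pow, RCLike.norm_conj]
    exact mul_le_of_le_one_right (norm_nonneg _)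
      (mul_le_one₀ (pow_le_one₀ (norm_nonneg _) hw) (by positivity)
        (pow_le_one₀ (norm_nonneg _) hw))
  have hcont : ContinuousOn (fun w : ℂ => ∑' p, a p * (w ^ p.1 * conj w ^ p.2))
      (Metric.closedBall 0 1) := by
    refine continuousOn_tsum (fun p => ?_) ha hb
    have : Continuous fun w : ℂ => conj w := Complex.continuous_conj
    fun_prop
  have heq : Set.EqOn (fun w : ℂ => ∑' p, a p * (w ^ p.1 * conj w ^ p.2)) g
      (Metric.closedBall 0 1) := by
    have h1 : Set.EqOn (fun w : ℂ => ∑' p, a p * (w ^ p.1 * conj w ^ p.2)) g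
        (Metric.ball 0 1) := fun w hw => (h w (by simpa using hw)).tsum_eq
    refine h1.of_subset_closure hcont hg Metric.ball_subset_closedBall ?_
    rw [closure_ball _ one_ne_zero]
  have hzm : z ∈ Metric.closedBall (0 : ℂ) 1 := by simpa using hz
  rw [← heq hzm]
  exact (Summable.of_norm_bounded ha fun p => hb p z hzm).hasSum

variable [Group L] [TopologicalSpace L]

theorem MemPSphere.continuousOn_left {q : ℕ} (hf : MemPSphere q f) (u : L) :
    ContinuousOn (fun z => f z u) (Metric.closedBall 0 1) :=
  hf.1.comp (f := fun z : ℂ => (z, u)) (by fun_prop) fun z hz => ⟨hz, trivial⟩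

theorem MemPSphere.continuous_right {q : ℕ} (hf : MemPSphere q f) {z : ℂ} (hz : ‖z‖ ≤ 1) :
    Continuous (f z) := by
  rw [← continuousOn_univ]
  exact hf.1.comp (f := fun u : L => (z, u)) (by fun_prop) fun u _ => ⟨by simpa using hz, trivial⟩

theorem MemPSphere.isPosDefKernel_approxCoeff {n M : ℕ} [NeZero n] [NeZero M]
    (hf : MemPSphere n f) (p : ℕ × ℕ) : IsPosDefKernel (groupKernel (approxCoeff n M f p)) := by
  refine isPosDefKernel_sum Finset.univ fun κ _ => ?_
  split_ifs
  · exact (hf.isPosDefKernel_sum_addChar _).const_mul (by positivity)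
  · intro N x c
    simp

variable [IsTopologicalGroup L]

theorem exists_isPowerExpansion (hf : MemPSphereInfty f) : ∃ φ, IsPowerExpansion f φ := by
  have hf2 := hf 2 le_rfl
  obtain ⟨C, hC⟩ := (isCompact_closedBall (0 : ℂ) 1).exists_bound_of_continuousOn
    (hf2.continuousOn_left 1)
  set A : ℕ → ℕ × ℕ → L → ℂ := fun n => approxCoeff (n + 2) (n + 3) f with hA
  have hpd : ∀ n p, IsPosDefKernel (groupKernel (A n p)) := fun n p =>
    (hf (n + 2) (by omega)).isPosDefKernel_approxCoeff p
  -- At `z = 1` all monomials equal `1`, so the nonnegative numbers `A n p 1` add up to `approx` at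
  -- `(1, 1)`.
  have hsumA : ∀ n (s : Finset (ℕ × ℕ)), ∑ p ∈ s, (A n p 1).re ≤ C := by
    intro n s
    have h1 := hasSum_approxCoeff (n := n + 2) (M := n + 3) (f := f) 1 1
    simp only [one_pow, map_one, mul_one] at h1
    have h2 := Complex.hasSum_re h1
    refine (sum_le_hasSum s (fun p _ => (hpd n p).re_one_nonneg) h2).trans ?_
    exact (Complex.re_le_norm _).trans (norm_approx_le (by simp) (by omega) hC)
  have hbound : ∀ n p u, ‖A n p u‖ ≤ C := fun n p u =>
    ((hpd n p).norm_le u).trans (by simpa using hsumA n {p})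
  -- An ultrafilter provides limits for all `p` and all `u` at once; `L` may be uncountable, so
  -- diagonal extraction of a subsequence would not do.
  have hlim : ∀ p u, ∃ a, Filter.Tendsto (fun n => A n p u) (Filter.hyperfilter ℕ) (nhds a) := by
    intro p u
    obtain ⟨a, -, ha⟩ := (isCompact_closedBall (0 : ℂ) C).ultrafilter_le_nhds'
      ((Filter.hyperfilter ℕ).map fun n => A n p u) (by
        rw [Ultrafilter.mem_map]
        exact Filter.Eventually.of_forall fun n => by simpa using hbound n p u)
    exact ⟨a, ha⟩
  choose φ hφ using hlim
  have hφpd : ∀ p, IsPosDefKernel (groupKernel (φ p)) := fun p =>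
    IsPosDefKernel.of_tendsto (fun n => hpd n p) fun x y => hφ p _
  have hφC : ∀ s : Finset (ℕ × ℕ), ∑ p ∈ s, (φ p 1).re ≤ C := by
    intro s
    refine le_of_tendsto' (x := ((Filter.hyperfilter ℕ : Ultrafilter ℕ) : Filter ℕ))
      (tendsto_finsetSum s fun p _ => ?_) fun n => hsumA n s
    exact (Complex.continuous_re.tendsto _).comp (hφ p 1)
  have hφs : Summable fun p => (φ p 1).re :=
    summable_of_sum_le (fun p => (hφpd p).re_one_nonneg) hφC
  have hφn : ∀ u, Summable fun p => ‖φ p u‖ := fun u =>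
    hφs.of_nonneg_of_le (fun p => norm_nonneg _) fun p => (hφpd p).norm_le u
  have hsum : ∀ z : ℂ, ‖z‖ ≤ 1 → ∀ u,
      HasSum (fun p : ℕ × ℕ => φ p u * (z ^ p.1 * conj z ^ p.2)) (f z u) := by
    intro z hz u
    refine hasSum_monomials_of_approx (hf2.continuousOn_left u) (hφn u) (fun z hz => ?_) hz
    -- Only the uniform bound `C` on the coefficients is available for domination, so the limit is
    -- taken for `‖z‖ < 1`.
    have hgeo : Summable fun p : ℕ × ℕ => C * (‖z‖ ^ p.1 * ‖z‖ ^ p.2) :=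
      ((summable_geometric_of_lt_one (norm_nonneg _) hz).mul_of_nonneg
        (summable_geometric_of_lt_one (norm_nonneg _) hz) (fun _ => by positivity)
        (fun _ => by positivity)).mul_left C
    have hle : ∀ (a : ℂ), ‖a‖ ≤ C → ∀ p : ℕ × ℕ,
        ‖a * (z ^ p.1 * conj z ^ p.2)‖ ≤ C * (‖z‖ ^ p.1 * ‖z‖ ^ p.2) := by
      intro a ha p
      rw [norm_mul, norm_mul, norm_pow, norm_pow, RCLike.norm_conj]
      gcongr
    have h1 := tendsto_tsum_of_dominated_convergence
      (𝓕 := ((Filter.hyperfilter ℕ : Ultrafilter ℕ) : Filter ℕ)) (f := fun n p =>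
        A n p u * (z ^ p.1 * conj z ^ p.2)) hgeo (fun p => (hφ p u).mul_const _)
      (.of_forall fun n p => hle _ (hbound n p u) p)
    have h2 := (tendsto_approx (hf2.continuousOn_left u) hz.le).mono_left
      Nat.hyperfilter_le_atTop
    have h3 : ∀ n, ∑' p : ℕ × ℕ, A n p u * (z ^ p.1 * conj z ^ p.2) =
        approx (n + 2) (n + 3) f z u := fun n => (hasSum_approxCoeff z u).tsum_eq
    simp only [h3] at h1
    rw [tendsto_nhds_unique h2 h1]
    have hφb : ∀ p, ‖φ p u‖ ≤ C := fun p =>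
      ((hφpd p).norm_le u).trans (by simpa using hφC {p})
    exact (Summable.of_norm_bounded hgeo fun p => hle _ (hφb p) p).hasSum
  refine ⟨fun m n => φ (m, n), fun m n => ⟨?_, hφpd (m, n)⟩, ?_, fun z hz u =>
    hsum z (by simpa using hz) u⟩
  -- A pointwise limit need not be continuous. But the nonnegative numbers `Re (φ p 1 - φ p u)` sum
  -- to `Re (f 1 1 - f 1 u)`, so each is dominated by the oscillation of the continuous function `f
  -- 1`.
  · refine (hφpd (m, n)).continuous_of_re_sub_le (h := f 1) (hf2.continuous_right (by simp)) ?_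
    intro u
    have h1 := Complex.hasSum_re (hsum 1 (by simp) 1)
    have h2 := Complex.hasSum_re (hsum 1 (by simp) u)
    simp only [one_pow, map_one, mul_one] at h1 h2
    have h3 := h1.sub h2
    refine le_hasSum h3 (m, n) fun p _ => ?_
    have := ((Complex.re_le_norm _).trans ((hφpd p).norm_le u))
    linarith
  · have := Complex.ofRealCLM.summable hφs
    refine this.congr fun p => ?_
    exact (hφpd p).ofReal_re_one

end Existence

/-! ### Power series in `z` and `conj z` -/

/-- Double sequences of polynomial growth. -/
def PolyGrowth (a : ℕ × ℕ → ℂ) : Prop :=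
  ∃ (C : ℝ) (k : ℕ), 0 ≤ C ∧ ∀ p, ‖a p‖ ≤ C * ((p.1 + 1 : ℝ) ^ k * (p.2 + 1 : ℝ) ^ k)

/-- The sum of the series with coefficients `a` in `z` and `conj z`. -/
def conjSeries (a : ℕ × ℕ → ℂ) (z : ℂ) : ℂ := ∑' p : ℕ × ℕ, a p * (z ^ p.1 * conj z ^ p.2)

/-- The coefficients of the derivative with respect to `z`. -/
def shiftFst (a : ℕ × ℕ → ℂ) (p : ℕ × ℕ) : ℂ := (p.1 + 1) * a (p.1 + 1, p.2)

/-- The coefficients of the derivative with respect to `conj z`. -/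
def shiftSnd (a : ℕ × ℕ → ℂ) (p : ℕ × ℕ) : ℂ := (p.2 + 1) * a (p.1, p.2 + 1)

/-- Polynomial growth, unlike boundedness, survives termwise differentiation, so smoothness can be
proved by induction within this class. -/
theorem PolyGrowth.shiftFst {a : ℕ × ℕ → ℂ} (ha : PolyGrowth a) : PolyGrowth (shiftFst a) := by
  obtain ⟨C, k, hC, h⟩ := ha
  refine ⟨C * 2 ^ k, k + 1, by positivity, fun p => ?_⟩
  have h1 := h (p.1 + 1, p.2)
  have h2 : ‖((p.1 : ℂ) + 1)‖ = p.1 + 1 := by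
    rw [← Nat.cast_add_one, Complex.norm_natCast, Nat.cast_add_one]
  rw [PDSphere.shiftFst, norm_mul, h2]
  push_cast at h1
  calc _ ≤ (p.1 + 1 : ℝ) * (C * ((2 * (p.1 + 1) : ℝ) ^ k * (p.2 + 1 : ℝ) ^ k)) := by
        refine mul_le_mul_of_nonneg_left (h1.trans ?_) (by positivity)
        gcongr
        have : (0 : ℝ) ≤ p.1 := by positivity
        linarith
    _ = C * 2 ^ k * ((p.1 + 1 : ℝ) ^ (k + 1) * (p.2 + 1 : ℝ) ^ k) := by
        rw [mul_pow]
        ring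
    _ ≤ _ := by
        gcongr
        · have : (0 : ℝ) ≤ p.2 := by positivity
          linarith
        · omega

theorem PolyGrowth.shiftSnd {a : ℕ × ℕ → ℂ} (ha : PolyGrowth a) : PolyGrowth (shiftSnd a) := by
  have h : PolyGrowth fun p => a p.swap := by
    obtain ⟨C, k, hC, h⟩ := ha
    exact ⟨C, k, hC, fun p => (h p.swap).trans_eq (by simp [mul_comm])⟩
  obtain ⟨C, k, hC, h⟩ := h.shiftFst
  exact ⟨C, k, hC, fun p => (h p.swap).trans_eq (by simp [mul_comm])⟩

theorem summable_polyGrowth {ρ : ℝ} (h0 : 0 < ρ) (h1 : ρ < 1) (C : ℝ) (k : ℕ) :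
    Summable fun p : ℕ × ℕ =>
      C * ((p.1 + 1 : ℝ) ^ k * (p.2 + 1 : ℝ) ^ k) * (ρ ^ p.1 * ρ ^ p.2) := by
  have hs : Summable fun n : ℕ => (n + 1 : ℝ) ^ k * ρ ^ n := by
    have := summable_pow_mul_geometric_of_norm_lt_one (R := ℝ) k (r := ρ)
      (by rwa [Real.norm_eq_abs, abs_of_pos h0])
    have := ((summable_nat_add_iff 1).2 this).mul_right ρ⁻¹
    refine this.congr fun n => ?_
    rw [pow_succ]
    push_cast
    field_simp
  have := (hs.mul_of_nonneg hs (fun _ => by positivity) (fun _ => by positivity)).mul_left C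
  exact this.congr fun p => by ring

theorem tsum_shiftFst (a : ℕ × ℕ → ℂ) (z : ℂ) :
    ∑' p : ℕ × ℕ, a p * (p.1 * z ^ (p.1 - 1) * conj z ^ p.2) = conjSeries (shiftFst a) z := by
  have hinj : Function.Injective fun p : ℕ × ℕ => (p.1 + 1, p.2) := by
    rintro ⟨a, b⟩ ⟨c, d⟩ h
    simpa using h
  rw [← hinj.tsum_eq]
  · refine tsum_congr fun p => ?_
    simp [shiftFst]
    ring
  · rintro ⟨m, n⟩ h
    rcases m with _ | m
    · simp at h
    · exact ⟨(m, n), rfl⟩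

theorem tsum_shiftSnd (a : ℕ × ℕ → ℂ) (z : ℂ) :
    ∑' p : ℕ × ℕ, a p * (z ^ p.1 * (p.2 * conj z ^ (p.2 - 1))) = conjSeries (shiftSnd a) z := by
  have hinj : Function.Injective fun p : ℕ × ℕ => (p.1, p.2 + 1) := by
    rintro ⟨a, b⟩ ⟨c, d⟩ h
    simpa using h
  rw [← hinj.tsum_eq]
  · refine tsum_congr fun p => ?_
    simp [shiftSnd]
    ring
  · rintro ⟨m, n⟩ h
    rcases n with _ | n
    · simp at h
    · exact ⟨(m, n), rfl⟩

theorem hasFDerivAt_conjSeries {a : ℕ × ℕ → ℂ} (ha : PolyGrowth a) {z : ℂ} (hz : ‖z‖ < 1) :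
    HasFDerivAt (conjSeries a)
      (conjSeries (shiftFst a) z • (ContinuousLinearMap.id ℝ ℂ) +
        conjSeries (shiftSnd a) z • (Complex.conjCLE : ℂ →L[ℝ] ℂ)) z := by
  obtain ⟨ρ, hzρ, hρ1⟩ := exists_between hz
  have hρ0 : 0 < ρ := (norm_nonneg _).trans_lt hzρ
  obtain ⟨C, k, hC, hb⟩ := ha
  have hterm : ∀ (p : ℕ × ℕ) (w : ℂ), HasFDerivAt (fun w : ℂ => a p * (w ^ p.1 * conj w ^ p.2))
      ((a p * (p.1 * w ^ (p.1 - 1) * conj w ^ p.2)) • (ContinuousLinearMap.id ℝ ℂ) +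
        (a p * (w ^ p.1 * (p.2 * conj w ^ (p.2 - 1)))) • (Complex.conjCLE : ℂ →L[ℝ] ℂ)) w := by
    intro p w
    have h1 : HasFDerivAt (fun w : ℂ => w) (ContinuousLinearMap.id ℝ ℂ) w := hasFDerivAt_id w
    have h2 : HasFDerivAt (fun w : ℂ => conj w) (Complex.conjCLE : ℂ →L[ℝ] ℂ) w :=
      (Complex.conjCLE : ℂ →L[ℝ] ℂ).hasFDerivAt
    have h3 := ((h1.pow p.1).mul (h2.pow p.2)).const_mul (a p)
    refine h3.congr_fderiv ?_
    ext
    simp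
    ring
  -- One majorant for both partial derivatives: `ρ⁻¹` makes up for the lost power, the exponent `k +
  -- 1` absorbs the factor from differentiation, and `2` counts the two terms.
  set u : ℕ × ℕ → ℝ := fun p => C * ρ⁻¹ * 2 * ((p.1 + 1 : ℝ) ^ (k + 1) * (p.2 + 1 : ℝ) ^ (k + 1)) *
    (ρ ^ p.1 * ρ ^ p.2) with hu
  have hus : Summable u := summable_polyGrowth hρ0 hρ1 _ _
  have hpow : ∀ n : ℕ, (n : ℝ) * ρ ^ (n - 1) ≤ ρ⁻¹ * ((n + 1) * ρ ^ n) := by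
    intro n
    rcases n with _ | n
    · simp
      positivity
    · rw [Nat.add_sub_cancel, pow_succ]
      have : ρ⁻¹ * ((((n + 1 : ℕ) : ℝ) + 1) * (ρ ^ n * ρ)) = (((n + 1 : ℕ) : ℝ) + 1) * ρ ^ n := by
        field_simp
      rw [this]
      gcongr
      linarith
  have hone : ∀ n : ℕ, (1 : ℝ) ≤ n + 1 := fun n => by
    have : (0 : ℝ) ≤ n := by positivity
    linarith
  have hA : ∀ (p : ℕ × ℕ) (w : ℂ), ‖w‖ < ρ →
      ‖a p * (p.1 * w ^ (p.1 - 1) * conj w ^ p.2)‖ ≤ u p / 2 := by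
    intro p w hw
    simp only [norm_mul, norm_pow, RCLike.norm_conj, Complex.norm_natCast]
    calc _ ≤ C * ((p.1 + 1 : ℝ) ^ k * (p.2 + 1 : ℝ) ^ k) * (p.1 * ρ ^ (p.1 - 1) * ρ ^ p.2) := by
          gcongr
          exact hb p
      _ ≤ C * ((p.1 + 1 : ℝ) ^ k * (p.2 + 1 : ℝ) ^ k) *
          (ρ⁻¹ * ((p.1 + 1) * ρ ^ p.1) * ((p.2 + 1) * ρ ^ p.2)) := by
          refine mul_le_mul_of_nonneg_left (mul_le_mul (hpow _) ?_ (by positivity)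
            (by positivity)) (by positivity)
          exact le_mul_of_one_le_left (by positivity) (hone _)
      _ = u p / 2 := by
          simp only [hu]
          ring
  have hB : ∀ (p : ℕ × ℕ) (w : ℂ), ‖w‖ < ρ →
      ‖a p * (w ^ p.1 * (p.2 * conj w ^ (p.2 - 1)))‖ ≤ u p / 2 := by
    intro p w hw
    simp only [norm_mul, norm_pow, RCLike.norm_conj, Complex.norm_natCast]
    calc _ ≤ C * ((p.1 + 1 : ℝ) ^ k * (p.2 + 1 : ℝ) ^ k) * (ρ ^ p.1 * (p.2 * ρ ^ (p.2 - 1))) := by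
          gcongr
          exact hb p
      _ ≤ C * ((p.1 + 1 : ℝ) ^ k * (p.2 + 1 : ℝ) ^ k) *
          (((p.1 + 1) * ρ ^ p.1) * (ρ⁻¹ * ((p.2 + 1) * ρ ^ p.2))) := by
          refine mul_le_mul_of_nonneg_left (mul_le_mul ?_ (hpow _) (by positivity)
            (by positivity)) (by positivity)
          exact le_mul_of_one_le_left (by positivity) (hone _)
      _ = u p / 2 := by
          simp only [hu]
          ring
  have hu2 : Summable fun p => u p / 2 := hus.div_const 2
  have hzρ' : z ∈ Metric.ball (0 : ℂ) ρ := by simpa using hzρ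
  have h := hasFDerivAt_tsum_of_isPreconnected hus Metric.isOpen_ball
    (convex_ball (0 : ℂ) ρ).isPreconnected (fun p w _ => hterm p w) (fun p w hw => ?_)
    (x₀ := 0) (by simpa using hρ0) ?_ hzρ'
  · refine h.congr_fderiv ?_
    have s1 : Summable fun p : ℕ × ℕ => a p * (p.1 * z ^ (p.1 - 1) * conj z ^ p.2) :=
      Summable.of_norm_bounded hu2 fun p => hA p z hzρ
    have s2 : Summable fun p : ℕ × ℕ => a p * (z ^ p.1 * (p.2 * conj z ^ (p.2 - 1))) :=
      Summable.of_norm_bounded hu2 fun p => hB p z hzρ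
    rw [(s1.smul_const _).tsum_add (s2.smul_const _), s1.tsum_smul_const, s2.tsum_smul_const,
      tsum_shiftFst, tsum_shiftSnd]
  · have hw' : ‖w‖ < ρ := by simpa using hw
    refine (norm_add_le _ _).trans ?_
    rw [norm_smul, norm_smul]
    have h1 : ‖(ContinuousLinearMap.id ℝ ℂ)‖ ≤ 1 := ContinuousLinearMap.norm_id_le
    have h2 : ‖(Complex.conjCLE : ℂ →L[ℝ] ℂ)‖ = 1 := Complex.conjCLE_norm
    rw [h2, mul_one]
    have := hA p w hw'
    have := hB p w hw'
    have := mul_le_of_le_one_right (norm_nonneg (a p * (p.1 * w ^ (p.1 - 1) * conj w ^ p.2))) h1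
    linarith
  -- Termwise differentiation needs convergence at one point; at the origin only the constant term
  -- survives.
  · refine summable_of_ne_finset_zero (s := {(0, 0)}) fun p hp => ?_
    have : p.1 ≠ 0 ∨ p.2 ≠ 0 := by
      by_contra! hh
      exact hp (by simp [Prod.ext_iff, hh])
    rcases this with h | h <;> simp [h]

theorem contDiffOn_conjSeries {a : ℕ × ℕ → ℂ} (ha : PolyGrowth a) :
    ContDiffOn ℝ ∞ (conjSeries a) (Metric.ball (0 : ℂ) 1) := by
  rw [contDiffOn_infty]
  intro n
  induction n generalizing a with
  | zero =>
    refine contDiffOn_zero.2 fun z hz => ?_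
    exact (hasFDerivAt_conjSeries ha (by simpa using hz)).continuousAt.continuousWithinAt
  | succ n ih =>
    rw [Nat.cast_add_one, contDiffOn_succ_iff_fderiv_of_isOpen Metric.isOpen_ball]
    refine ⟨fun z hz => ?_, fun h => by simp at h, ?_⟩
    · exact (hasFDerivAt_conjSeries ha
        (by simpa using hz)).differentiableAt.differentiableWithinAt
    · refine (((ih ha.shiftFst).smul (contDiffOn_const (c := ContinuousLinearMap.id ℝ ℂ))).add
        ((ih ha.shiftSnd).smul
          (contDiffOn_const (c := (Complex.conjCLE : ℂ →L[ℝ] ℂ))))).congr fun z hz => ?_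
      exact (hasFDerivAt_conjSeries ha (by simpa using hz)).fderiv

theorem eqOn_dz {g : ℂ → ℂ} {a : ℕ × ℕ → ℂ} (ha : PolyGrowth a)
    (h : Set.EqOn g (conjSeries a) (Metric.ball 0 1)) :
    Set.EqOn (dz g) (conjSeries (shiftFst a)) (Metric.ball 0 1) := by
  intro z hz
  have hev : g =ᶠ[nhds z] conjSeries a := h.eventuallyEq_of_mem (Metric.isOpen_ball.mem_nhds hz)
  rw [dz, hev.fderiv_eq, (hasFDerivAt_conjSeries ha (by simpa using hz)).fderiv]
  simp
  linear_combination (-(conjSeries (shiftFst a) z) / 2 +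
    (conjSeries (shiftSnd a) z) / 2) * Complex.I_sq

theorem eqOn_dzbar {g : ℂ → ℂ} {a : ℕ × ℕ → ℂ} (ha : PolyGrowth a)
    (h : Set.EqOn g (conjSeries a) (Metric.ball 0 1)) :
    Set.EqOn (dzbar g) (conjSeries (shiftSnd a)) (Metric.ball 0 1) := by
  intro z hz
  have hev : g =ᶠ[nhds z] conjSeries a := h.eventuallyEq_of_mem (Metric.isOpen_ball.mem_nhds hz)
  rw [dzbar, hev.fderiv_eq, (hasFDerivAt_conjSeries ha (by simpa using hz)).fderiv]
  simp
  linear_combination (conjSeries (shiftFst a) z / 2 -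
    (conjSeries (shiftSnd a) z) / 2) * Complex.I_sq

theorem eqOn_iterate_dz {g : ℂ → ℂ} {a : ℕ × ℕ → ℂ} (ha : PolyGrowth a)
    (h : Set.EqOn g (conjSeries a) (Metric.ball 0 1)) (m : ℕ) :
    PolyGrowth (shiftFst^[m] a) ∧
      Set.EqOn (dz^[m] g) (conjSeries (shiftFst^[m] a)) (Metric.ball 0 1) := by
  induction m with
  | zero => exact ⟨ha, h⟩
  | succ m ih =>
    rw [Function.iterate_succ_apply', Function.iterate_succ_apply']
    exact ⟨ih.1.shiftFst, eqOn_dz ih.1 ih.2⟩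

theorem eqOn_iterate_dzbar {g : ℂ → ℂ} {a : ℕ × ℕ → ℂ} (ha : PolyGrowth a)
    (h : Set.EqOn g (conjSeries a) (Metric.ball 0 1)) (m : ℕ) :
    PolyGrowth (shiftSnd^[m] a) ∧
      Set.EqOn (dzbar^[m] g) (conjSeries (shiftSnd^[m] a)) (Metric.ball 0 1) := by
  induction m with
  | zero => exact ⟨ha, h⟩
  | succ m ih =>
    rw [Function.iterate_succ_apply', Function.iterate_succ_apply']
    exact ⟨ih.1.shiftSnd, eqOn_dzbar ih.1 ih.2⟩

theorem factorial_mul_iterate_shiftFst (a : ℕ × ℕ → ℂ) (m i j : ℕ) :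
    (i.factorial : ℂ) * shiftFst^[m] a (i, j) = (i + m).factorial * a (i + m, j) := by
  induction m generalizing i with
  | zero => simp
  | succ m ih =>
    rw [Function.iterate_succ_apply', shiftFst]
    have := ih (i + 1)
    rw [Nat.factorial_succ] at this
    push_cast at this
    rw [show i + (m + 1) = i + 1 + m by ring, ← this]
    ring

theorem factorial_mul_iterate_shiftSnd (a : ℕ × ℕ → ℂ) (m i j : ℕ) :
    (j.factorial : ℂ) * shiftSnd^[m] a (i, j) = (j + m).factorial * a (i, j + m) := by
  induction m generalizing j with
  | zero => simp
  | succ m ih =>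
    rw [Function.iterate_succ_apply', shiftSnd]
    have := ih (j + 1)
    rw [Nat.factorial_succ] at this
    push_cast at this
    rw [show j + (m + 1) = j + 1 + m by ring, ← this]
    ring

theorem conjSeries_zero (a : ℕ × ℕ → ℂ) : conjSeries a 0 = a (0, 0) := by
  rw [conjSeries, tsum_eq_single (0, 0)]
  · simp
  · rintro ⟨m, n⟩ h
    have : m ≠ 0 ∨ n ≠ 0 := by
      by_contra! hh
      exact h (by simp [hh])
    rcases this with h | h <;> simp [h]

theorem iterate_dz_dzbar_zero {g : ℂ → ℂ} {a : ℕ × ℕ → ℂ} (ha : PolyGrowth a)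
    (h : Set.EqOn g (conjSeries a) (Metric.ball 0 1)) (m n : ℕ) :
    (dz^[m] (dzbar^[n] g)) 0 = m.factorial * n.factorial * a (m, n) := by
  obtain ⟨h1, h2⟩ := eqOn_iterate_dzbar ha h n
  rw [(eqOn_iterate_dz h1 h2 m).2 (by simp), conjSeries_zero]
  have h3 := factorial_mul_iterate_shiftFst (shiftSnd^[n] a) m 0 0
  have h4 := factorial_mul_iterate_shiftSnd a n m 0
  simp only [Nat.factorial_zero, Nat.cast_one, one_mul, zero_add] at h3 h4
  rw [h3, h4, mul_assoc]

/-! ### Coefficients of a power expansion as derivatives at the origin -/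

section Group

variable {L : Type*} [Group L] [TopologicalSpace L] {f : ℂ → L → ℂ} {φ : ℕ → ℕ → L → ℂ}

theorem IsPowerExpansion.polyGrowth (h : IsPowerExpansion f φ) (u : L) :
    PolyGrowth fun p => φ p.1 p.2 u := by
  have hs := Complex.hasSum_re h.2.1.hasSum
  refine ⟨∑' p : ℕ × ℕ, (φ p.1 p.2 1).re, 0, ?_, fun p => ?_⟩
  · exact tsum_nonneg fun p => IsPosDefKernel.re_one_nonneg (h.1 p.1 p.2).2
  · rw [pow_zero, pow_zero, mul_one, mul_one]
    refine (IsPosDefKernel.norm_le (h.1 p.1 p.2).2 u).trans ?_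
    exact hs.summable.le_tsum p fun p _ => IsPosDefKernel.re_one_nonneg (h.1 p.1 p.2).2

theorem IsPowerExpansion.eqOn (h : IsPowerExpansion f φ) (u : L) :
    Set.EqOn (fun z => f z u) (conjSeries fun p => φ p.1 p.2 u) (Metric.ball 0 1) := fun z hz =>
  (h.2.2 z (Metric.ball_subset_closedBall hz) u).tsum_eq.symm

theorem IsPowerExpansion.eq_iterate (h : IsPowerExpansion f φ) (m n : ℕ) (u : L) :
    φ m n u = 1 / ((m.factorial : ℂ) * (n.factorial : ℂ)) *
      (dz^[m] (dzbar^[n] (fun z => f z u))) 0 := by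
  rw [iterate_dz_dzbar_zero (h.polyGrowth u) (h.eqOn u)]
  have h1 : (m.factorial : ℂ) ≠ 0 := by exact_mod_cast m.factorial_ne_zero
  have h2 : (n.factorial : ℂ) ≠ 0 := by exact_mod_cast n.factorial_ne_zero
  field_simp

end Group

section Jacobi

open Polynomial

/-! ### Jacobi polynomials with natural parameters -/

theorem poch_natCast_add_one (a s : ℕ) :
    poch ((a : ℝ) + 1) s = ((a + s).factorial : ℝ) / (a.factorial : ℝ) := by
  rw [poch, ← Nat.cast_add_one, ascPochhammer_nat_eq_natCast_ascFactorial,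
    ← Nat.factorial_mul_ascFactorial a s, Nat.cast_mul, mul_div_cancel_left₀]
  exact_mod_cast a.factorial_ne_zero

theorem poch_neg_natCast (n s : ℕ) :
    poch (-(n : ℝ)) s = (-1) ^ s * (s.factorial * n.choose s) := by
  rw [poch, ascPochhammer_eval_neg_eq_descPochhammer, descPochhammer_eval_eq_descFactorial,
    Nat.descFactorial_eq_factorial_mul_choose, Nat.cast_mul]

/-- The coefficients of the normalized Jacobi polynomial on `[0, 1]` in powers of `1 - t`. -/
def jacobiCoeff (α d n s : ℕ) : ℝ :=
  (-1) ^ s * n.choose s * (((n + α + d + s).factorial * α.factorial : ℝ) /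
    ((n + α + d).factorial * (α + s).factorial))

/-- The normalized Jacobi polynomial with parameters `α`, `d`, transported to `[0, 1]`. -/
def jacobiPoly (α d n : ℕ) : ℝ[X] :=
  ∑ s ∈ Finset.range (n + 1), C (jacobiCoeff α d n s) * (1 - X) ^ s

theorem jacobiP_one (α β : ℝ) (k : ℕ) :
    jacobiP α β k 1 = poch (α + 1) k / (k.factorial : ℝ) := by
  rw [jacobiP, Finset.sum_range_succ']
  simp [poch]

theorem jacobiR_eq_eval (α d n : ℕ) (t : ℝ) :
    jacobiR α d n (2 * t - 1) = (jacobiPoly α d n).eval t := by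
  have h0 : poch ((α : ℝ) + 1) n / (n.factorial : ℝ) ≠ 0 := by
    rw [poch_natCast_add_one]
    positivity
  rw [jacobiR, jacobiP_one, jacobiP, mul_div_cancel_left₀ _ h0, jacobiPoly, eval_finsetSum]
  refine Finset.sum_congr rfl fun s _ => ?_
  have h1 : ((n : ℝ) + α + d + 1) = ((n + α + d : ℕ) : ℝ) + 1 := by push_cast; ring
  rw [poch_neg_natCast, h1, poch_natCast_add_one, poch_natCast_add_one, jacobiCoeff]
  simp only [eval_mul, eval_C, eval_pow, eval_sub, eval_one, eval_X]
  have h2 : (1 - (2 * t - 1)) / 2 = 1 - t := by ring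
  rw [h2]
  have h3 : (s.factorial : ℝ) ≠ 0 := by positivity
  field_simp

theorem eval_one_jacobiPoly (α d n : ℕ) : (jacobiPoly α d n).eval 1 = 1 := by
  rw [jacobiPoly, eval_finsetSum, Finset.sum_range_succ']
  have h3 : ((n + α + d).factorial : ℝ) ≠ 0 := by positivity
  have h4 : (α.factorial : ℝ) ≠ 0 := by positivity
  simp [jacobiCoeff, h3, h4]

theorem natDegree_one_sub_X_pow_le (n : ℕ) : ((1 - X : ℝ[X]) ^ n).natDegree ≤ n := by
  have h1 : ((1 : ℝ[X]) - X).natDegree ≤ 1 := (natDegree_sub_le _ _).trans (by simp)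
  refine natDegree_pow_le.trans ?_
  nlinarith

theorem degree_jacobiPoly_lt (α d n : ℕ) : (jacobiPoly α d n).degree < (n + 1 : ℕ) := by
  have : (jacobiPoly α d n).natDegree ≤ n := by
    refine natDegree_sum_le_of_forall_le _ _ fun s hs => ?_
    refine (natDegree_C_mul_le _ _).trans ((natDegree_one_sub_X_pow_le s).trans ?_)
    exact Nat.lt_succ_iff.1 (Finset.mem_range.1 hs)
  exact degree_le_natDegree.trans_lt (by exact_mod_cast Nat.lt_succ_iff.2 this)

/-- The leading coefficient of `jacobiPoly α d n`. -/
def jacobiLead (α d n : ℕ) : ℝ :=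
  ((n + α + d + n).factorial * α.factorial : ℝ) / ((n + α + d).factorial * (α + n).factorial)

theorem jacobiLead_pos (α d n : ℕ) : 0 < jacobiLead α d n := by
  unfold jacobiLead
  positivity

theorem coeff_one_sub_X_pow (n : ℕ) : ((1 - X : ℝ[X]) ^ n).coeff n = (-1) ^ n := by
  have : (1 - X : ℝ[X]) ^ n = C ((-1) ^ n) * (X - C 1) ^ n := by
    rw [C_pow, ← mul_pow]
    simp
  rw [this, coeff_C_mul]
  have h := (monic_X_sub_C (1 : ℝ)).pow n
  have h2 : ((X - C (1 : ℝ)) ^ n).natDegree = n := by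
    rw [natDegree_pow, natDegree_X_sub_C, mul_one]
  rw [Monic, leadingCoeff, h2] at h
  rw [h, mul_one]

theorem coeff_jacobiPoly_self (α d n : ℕ) : (jacobiPoly α d n).coeff n = jacobiLead α d n := by
  rw [jacobiPoly, finsetSum_coeff, Finset.sum_range_succ, Finset.sum_eq_zero, zero_add,
    coeff_C_mul, coeff_one_sub_X_pow, jacobiCoeff, Nat.choose_self, jacobiLead]
  · have : ((-1 : ℝ) ^ n) * (-1) ^ n = 1 := by rw [← mul_pow]; simp
    rw [mul_right_comm, mul_right_comm _ _ ((-1 : ℝ) ^ n), this]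
    simp
  · intro s hs
    rw [coeff_C_mul, coeff_eq_zero_of_natDegree_lt, mul_zero]
    exact (natDegree_one_sub_X_pow_le s).trans_lt (Finset.mem_range.1 hs)

/-! ### The weighted integral -/

/-- Integration over `[0, 1]` against the weight `t ^ d * (1 - t) ^ α`. -/
def wInt (α d : ℕ) : ℝ[X] →ₗ[ℝ] ℝ where
  toFun p := ∫ t in (0 : ℝ)..1, p.eval t * (t ^ d * (1 - t) ^ α)
  map_add' p q := by
    rw [← intervalIntegral.integral_add]
    · simp [add_mul]
    · exact Continuous.intervalIntegrable (by fun_prop) _ _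
    · exact Continuous.intervalIntegrable (by fun_prop) _ _
  map_smul' c p := by
    rw [RingHom.id_apply, smul_eq_mul, ← intervalIntegral.integral_const_mul]
    simp [mul_assoc]

theorem wInt_apply (α d : ℕ) (p : ℝ[X]) :
    wInt α d p = ∫ t in (0 : ℝ)..1, p.eval t * (t ^ d * (1 - t) ^ α) := rfl

theorem wInt_C_mul (α d : ℕ) (c : ℝ) (p : ℝ[X]) : wInt α d (C c * p) = c * wInt α d p := by
  rw [C_mul', map_smul, smul_eq_mul]

theorem wInt_one_sub_X_mul (α d : ℕ) (p : ℝ[X]) :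
    wInt α d ((1 - X) * p) = wInt (α + 1) d p := by
  rw [wInt_apply, wInt_apply]
  congr 1
  ext t
  simp
  ring

theorem wInt_nonneg (α d : ℕ) {p : ℝ[X]} (hp : ∀ t ∈ Set.Icc (0 : ℝ) 1, 0 ≤ p.eval t) :
    0 ≤ wInt α d p := by
  rw [wInt_apply]
  refine intervalIntegral.integral_nonneg zero_le_one fun t ht => ?_
  have := hp t ht
  have h1 := ht.1
  have h2 : 0 ≤ 1 - t := by linarith [ht.2]
  positivity

theorem wInt_mul_self_pos (α d : ℕ) {p : ℝ[X]} (hp : p ≠ 0) : 0 < wInt α d (p * p) := by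
  have hnn := wInt_nonneg α d (p := p * p) fun t _ => by
    rw [eval_mul]
    exact mul_self_nonneg _
  refine lt_of_le_of_ne hnn fun h0 => ?_
  have hcont : Continuous fun t : ℝ => (p * p).eval t * (t ^ d * (1 - t) ^ α) := by fun_prop
  have hfin : (p.roots.toFinset : Set ℝ).Finite := Finset.finite_toSet _
  obtain ⟨t, ht, htr⟩ : ∃ t ∈ Set.Ioo (0 : ℝ) 1, t ∉ (p.roots.toFinset : Set ℝ) := by
    by_contra! h
    exact (Set.Ioo_infinite (zero_lt_one (α := ℝ))) (hfin.subset h)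
  have hpt : p.eval t ≠ 0 := by
    intro h
    exact htr (by simp [hp, IsRoot, h])
  refine (intervalIntegral.integral_pos zero_lt_one hcont.continuousOn (fun x hx => ?_)
    ⟨t, ⟨ht.1.le, ht.2.le⟩, ?_⟩).ne h0
  · have h1 := hx.1.le
    have h2 : 0 ≤ 1 - x := by linarith [hx.2]
    rw [eval_mul]
    have := mul_self_nonneg (p.eval x)
    positivity
  · have h1 := ht.1
    have h2 : 0 < 1 - t := by linarith [ht.2]
    rw [eval_mul]
    have := mul_self_pos.2 hpt
    positivity

theorem integral_pow_mul_one_sub_pow (a b : ℕ) :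
    ∫ t in (0 : ℝ)..1, t ^ a * (1 - t) ^ b =
      (a.factorial * b.factorial : ℝ) / (a + b + 1).factorial := by
  induction b generalizing a with
  | zero =>
    simp only [pow_zero, mul_one, integral_pow, Nat.factorial_zero, Nat.cast_one, add_zero]
    rw [Nat.factorial_succ]
    push_cast
    have : (a.factorial : ℝ) ≠ 0 := by positivity
    field_simp
    simp
  | succ b ih =>
    have hder : ∀ t : ℝ, HasDerivAt (fun t : ℝ => t ^ (a + 1) * (1 - t) ^ (b + 1))
        ((a + 1) * (t ^ a * (1 - t) ^ (b + 1)) - (b + 1) * (t ^ (a + 1) * (1 - t) ^ b)) t := by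
      intro t
      have h1 := hasDerivAt_pow (a + 1) t
      have h2 := (((hasDerivAt_id t).const_sub 1).pow (b + 1))
      refine (h1.mul h2).congr_deriv ?_
      simp
      ring
    have h := intervalIntegral.integral_eq_sub_of_hasDerivAt (a := (0 : ℝ)) (b := 1)
      (fun t _ => hder t) (Continuous.intervalIntegrable (by fun_prop) _ _)
    rw [intervalIntegral.integral_sub (Continuous.intervalIntegrable (by fun_prop) _ _)
      (Continuous.intervalIntegrable (by fun_prop) _ _), intervalIntegral.integral_const_mul,
      intervalIntegral.integral_const_mul, ih (a + 1)] at h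
    simp only [sub_self, ne_eq, Nat.add_eq_zero_iff, one_ne_zero, and_false, not_false_eq_true,
      zero_pow, mul_zero, zero_mul] at h
    have h3 : (a + 1 : ℝ) ≠ 0 := by positivity
    have h4 : ∫ t in (0 : ℝ)..1, t ^ a * (1 - t) ^ (b + 1) =
        (b + 1) * (((a + 1).factorial * b.factorial : ℝ) / (a + 1 + b + 1).factorial) /
          (a + 1) := by
      rw [eq_div_iff h3]
      linarith
    rw [h4, show a + (b + 1) + 1 = a + 1 + b + 1 by ring, Nat.factorial_succ a,
      Nat.factorial_succ b]
    push_cast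
    field_simp

theorem wInt_X_pow_mul_one_sub_X_pow (α d i j : ℕ) :
    wInt α d (X ^ i * (1 - X) ^ j) =
      ((d + i).factorial * (α + j).factorial : ℝ) / (d + i + (α + j) + 1).factorial := by
  rw [wInt_apply, ← integral_pow_mul_one_sub_pow]
  congr 1
  ext t
  simp
  ring

/-- The sum is, up to sign, an `n`-th finite difference at `0`, which kills polynomials of degree
below `n`. -/
theorem alternating_sum_choose_mul_eval {n : ℕ} {P : ℝ[X]} (hP : P.natDegree < n) :
    ∑ s ∈ Finset.range (n + 1), (-1 : ℝ) ^ s * n.choose s * P.eval (s : ℝ) = 0 := by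
  have h := congrFun (Polynomial.fwdDiff_iter_eq_zero_of_degree_lt hP) 0
  rw [fwdDiff_iter_eq_sum_shift] at h
  have h2 := congrArg (fun y => (-1 : ℝ) ^ n * y) h
  simp only [Finset.mul_sum, Pi.zero_apply, mul_zero] at h2
  rw [← h2]
  refine Finset.sum_congr rfl fun s hs => ?_
  have hs' : s ≤ n := Nat.lt_succ_iff.1 (Finset.mem_range.1 hs)
  obtain ⟨k, rfl⟩ := Nat.exists_eq_add_of_le hs'
  have h3 : (-1 : ℝ) ^ (s + k) = (-1) ^ s * (-1) ^ k := pow_add _ _ _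
  have h4 : (-1 : ℝ) ^ k * (-1) ^ k = 1 := by rw [← mul_pow]; simp
  simp only [zsmul_eq_mul, Nat.add_sub_cancel_left, h3]
  push_cast
  simp only [nsmul_eq_mul, mul_one, zero_add]
  linear_combination (-((-1 : ℝ) ^ s * (s + k).choose s * P.eval (s : ℝ))) * h4

/-- By the beta integral, the term of index `s` is a constant times `(-1) ^ s * n.choose s` times a
quotient of factorials that is a polynomial in `s` of degree `n - j - 1`. The alternating sum
therefore vanishes. -/
theorem wInt_X_pow_mul_jacobiPoly (α d : ℕ) {n j : ℕ} (hj : j < n) :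
    wInt α d (X ^ j * jacobiPoly α d n) = 0 := by
  obtain ⟨k, rfl⟩ := Nat.exists_eq_add_of_lt hj
  set n := j + k + 1 with hn
  set P : ℝ[X] := (ascPochhammer ℝ k).comp (X + C ((d + j + α + 1 : ℕ) + 1 : ℝ)) with hP
  have hdeg : P.natDegree < n := by
    rw [hP, natDegree_comp, ascPochhammer_natDegree, natDegree_X_add_C]
    omega
  have h := alternating_sum_choose_mul_eval hdeg
  rw [jacobiPoly, Finset.mul_sum, map_sum]
  have hterm : ∀ s, wInt α d (X ^ j * (C (jacobiCoeff α d n s) * (1 - X) ^ s)) =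
      (α.factorial * (d + j).factorial / (n + α + d).factorial : ℝ) *
        ((-1 : ℝ) ^ s * n.choose s * P.eval (s : ℝ)) := by
    intro s
    rw [mul_left_comm, wInt_C_mul, wInt_X_pow_mul_one_sub_X_pow]
    have he : P.eval (s : ℝ) =
        ((n + α + d + s).factorial : ℝ) / (d + j + (α + s) + 1).factorial := by
      have := poch_natCast_add_one (d + j + α + 1 + s) k
      rw [poch] at this
      rw [hP, eval_comp]
      simp only [eval_add, eval_X, eval_C]
      rw [show d + j + (α + s) + 1 = d + j + α + 1 + s by ring,
        show n + α + d + s = d + j + α + 1 + s + k by omega, ← this]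
      push_cast
      ring_nf
    rw [he, jacobiCoeff]
    have : ((α + s).factorial : ℝ) ≠ 0 := by positivity
    field_simp
  simp only [hterm]
  rw [← Finset.mul_sum, h, mul_zero]

/-! ### Orthogonal expansions -/

theorem wInt_mul_eq_zero_of_degree_lt {α d n : ℕ} {p q : ℝ[X]} (hp : p.degree < n)
    (hq : ∀ j < n, wInt α d (X ^ j * q) = 0) : wInt α d (p * q) = 0 := by
  by_cases h0 : p = 0
  · simp [h0]
  rw [p.as_sum_range' n ((natDegree_lt_iff_degree_lt h0).2 hp), Finset.sum_mul, map_sum]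
  refine Finset.sum_eq_zero fun j hj => ?_
  rw [← C_mul_X_pow_eq_monomial, mul_assoc, wInt_C_mul, hq j (Finset.mem_range.1 hj), mul_zero]

theorem wInt_mul_jacobiPoly_of_degree_lt {α d n : ℕ} {p : ℝ[X]} (hp : p.degree < n) :
    wInt α d (p * jacobiPoly α d n) = 0 :=
  wInt_mul_eq_zero_of_degree_lt hp fun _ hj => wInt_X_pow_mul_jacobiPoly α d hj

theorem jacobiPoly_ne_zero (α d n : ℕ) : jacobiPoly α d n ≠ 0 := by
  intro h
  simpa [h] using eval_one_jacobiPoly α d n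

/-- The squared norm of `jacobiPoly α d n`. -/
def jacobiNorm (α d n : ℕ) : ℝ := wInt α d (jacobiPoly α d n * jacobiPoly α d n)

theorem jacobiNorm_pos (α d n : ℕ) : 0 < jacobiNorm α d n :=
  wInt_mul_self_pos α d (jacobiPoly_ne_zero α d n)

theorem degree_sub_jacobiPoly_lt (α d : ℕ) {n : ℕ} {p : ℝ[X]} (hp : p.degree < (n + 1 : ℕ)) :
    (p - C (p.coeff n / jacobiLead α d n) * jacobiPoly α d n).degree < n := by
  rw [degree_lt_iff_coeff_zero] at hp ⊢
  intro m hm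
  have hQ := (degree_lt_iff_coeff_zero _ _).1 (degree_jacobiPoly_lt α d n)
  rw [coeff_sub, coeff_C_mul]
  rcases hm.eq_or_lt with rfl | h
  · rw [coeff_jacobiPoly_self, div_mul_cancel₀ _ (jacobiLead_pos α d n).ne', sub_self]
  · rw [hp m h, hQ m h, mul_zero, sub_zero]

theorem wInt_mul_jacobiPoly {α d n : ℕ} {p : ℝ[X]} (hp : p.degree < (n + 1 : ℕ)) :
    wInt α d (p * jacobiPoly α d n) = p.coeff n / jacobiLead α d n * jacobiNorm α d n := by
  have h := wInt_mul_jacobiPoly_of_degree_lt (α := α) (d := d) (degree_sub_jacobiPoly_lt α d hp)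
  rw [sub_mul, map_sub, mul_assoc, wInt_C_mul, sub_eq_zero] at h
  exact h

theorem wInt_jacobiPoly_mul_of_ne {α d m n : ℕ} (h : m ≠ n) :
    wInt α d (jacobiPoly α d m * jacobiPoly α d n) = 0 := by
  rcases lt_or_gt_of_ne h with h | h
  · refine wInt_mul_jacobiPoly_of_degree_lt ((degree_jacobiPoly_lt α d m).trans_le ?_)
    exact_mod_cast h
  · rw [mul_comm]
    refine wInt_mul_jacobiPoly_of_degree_lt ((degree_jacobiPoly_lt α d n).trans_le ?_)
    exact_mod_cast h

theorem eq_sum_jacobiPoly (α d : ℕ) {n : ℕ} {p : ℝ[X]} (hp : p.degree < n) :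
    p = ∑ j ∈ Finset.range n,
      C (wInt α d (p * jacobiPoly α d j) / jacobiNorm α d j) * jacobiPoly α d j := by
  induction n generalizing p with
  | zero => simpa using hp
  | succ n ih =>
    have h := ih (degree_sub_jacobiPoly_lt α d hp)
    rw [Finset.sum_range_succ, wInt_mul_jacobiPoly hp,
      mul_div_cancel_right₀ _ (jacobiNorm_pos α d n).ne', ← sub_eq_iff_eq_add, h]
    refine Finset.sum_congr rfl fun j hj => ?_
    rw [sub_mul, map_sub, mul_assoc, wInt_C_mul,
      wInt_jacobiPoly_mul_of_ne (Finset.mem_range.1 hj).ne', mul_zero, sub_zero]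

/-- Orthogonality to lower powers leaves only the top term of the Jacobi expansion, and the value at
`1` fixes its factor. -/
theorem eq_jacobiPoly_of_orthogonal {α d n : ℕ} {p : ℝ[X]} (hp : p.degree < (n + 1 : ℕ))
    (hp1 : p.eval 1 = 1) (horth : ∀ j < n, wInt α d (X ^ j * p) = 0) : p = jacobiPoly α d n := by
  have h := eq_sum_jacobiPoly α d hp
  rw [Finset.sum_range_succ, Finset.sum_eq_zero, zero_add] at h
  · have h1 := congrArg (eval 1) h
    rw [eval_mul, eval_C, eval_one_jacobiPoly, mul_one, hp1] at h1
    rw [← h1, C_1, one_mul] at h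
    exact h
  · intro j hj
    have hj' := Finset.mem_range.1 hj
    rw [mul_comm p, wInt_mul_eq_zero_of_degree_lt _ horth, zero_div, C_0, zero_mul]
    exact (degree_jacobiPoly_lt α d j).trans_le (by exact_mod_cast hj')

/-! ### Nonnegative expansion of monomials in Jacobi polynomials -/

theorem coeff_X_mul_jacobiPoly_nonneg {α d i j : ℕ} (h : i < j) :
    0 ≤ (X * jacobiPoly α d i).coeff j := by
  obtain ⟨j, rfl⟩ := Nat.exists_eq_succ_of_ne_zero (Nat.ne_zero_of_lt h)
  rw [Nat.succ_eq_add_one, coeff_X_mul]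
  rcases (Nat.lt_succ_iff.1 h).eq_or_lt with rfl | h'
  · rw [coeff_jacobiPoly_self]
    exact (jacobiLead_pos α d i).le
  · rw [(degree_lt_iff_coeff_zero _ _).1 (degree_jacobiPoly_lt α d i) j h']

theorem degree_X_mul_jacobiPoly_lt (α d i : ℕ) :
    (X * jacobiPoly α d i).degree < ((i + 2 : ℕ) : WithBot ℕ) := by
  rw [degree_lt_iff_coeff_zero]
  intro m hm
  obtain ⟨m, rfl⟩ := Nat.exists_eq_succ_of_ne_zero (show m ≠ 0 by omega)
  rw [Nat.succ_eq_add_one, coeff_X_mul]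
  exact (degree_lt_iff_coeff_zero _ _).1 (degree_jacobiPoly_lt α d i) m (by omega)

/-- For `i < j` only the coefficient of degree `j` of the product with `X` matters: it is a positive
leading coefficient if `j = i + 1` and zero otherwise. The diagonal entry integrates `t` times a
square, and the matrix is symmetric. -/
theorem wInt_X_mul_jacobiPoly_nonneg (α d i j : ℕ) :
    0 ≤ wInt α d (X * jacobiPoly α d i * jacobiPoly α d j) := by
  have key : ∀ i j, i < j → 0 ≤ wInt α d (X * jacobiPoly α d i * jacobiPoly α d j) := by
    intro i j h
    rw [wInt_mul_jacobiPoly ((degree_X_mul_jacobiPoly_lt α d i).trans_le ?_)]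
    · have := coeff_X_mul_jacobiPoly_nonneg (α := α) (d := d) h
      have := jacobiLead_pos α d j
      have := jacobiNorm_pos α d j
      positivity
    · exact_mod_cast (by omega : i + 2 ≤ j + 1)
  rcases lt_trichotomy i j with h | rfl | h
  · exact key i j h
  · refine wInt_nonneg α d fun t ht => ?_
    rw [mul_assoc, eval_mul, eval_mul, eval_X]
    exact mul_nonneg ht.1 (mul_self_nonneg _)
  · rw [mul_right_comm]
    exact key j i h

theorem wInt_X_pow_mul_jacobiPoly_nonneg (α d k j : ℕ) :
    0 ≤ wInt α d (X ^ k * jacobiPoly α d j) := by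
  induction k generalizing j with
  | zero =>
    rcases Nat.eq_zero_or_pos j with rfl | hj
    · rw [pow_zero, wInt_mul_jacobiPoly (by simp)]
      have := jacobiLead_pos α d 0
      have := jacobiNorm_pos α d 0
      simp
      positivity
    · rw [wInt_X_pow_mul_jacobiPoly α d hj]
  | succ k ih =>
    rw [pow_succ, mul_assoc, eq_sum_jacobiPoly α d (degree_X_mul_jacobiPoly_lt α d j),
      Finset.mul_sum, map_sum]
    refine Finset.sum_nonneg fun i _ => ?_
    rw [mul_left_comm, wInt_C_mul]
    exact mul_nonneg (div_nonneg (wInt_X_mul_jacobiPoly_nonneg α d j i)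
      (jacobiNorm_pos α d i).le) (ih i)

/-- The coefficients of the monomials in the basis of Jacobi polynomials. -/
def monoCoeff (α d k j : ℕ) : ℝ := wInt α d (X ^ k * jacobiPoly α d j) / jacobiNorm α d j

theorem monoCoeff_nonneg (α d k j : ℕ) : 0 ≤ monoCoeff α d k j :=
  div_nonneg (wInt_X_pow_mul_jacobiPoly_nonneg α d k j) (jacobiNorm_pos α d j).le

theorem pow_eq_sum_monoCoeff (α d k : ℕ) (t : ℝ) :
    t ^ k = ∑ j ∈ Finset.range (k + 1), monoCoeff α d k j * (jacobiPoly α d j).eval t := by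
  have h := eq_sum_jacobiPoly α d (p := X ^ k) (n := k + 1) (by
    rw [degree_X_pow]
    exact_mod_cast Nat.lt_succ_self k)
  have := congrArg (eval t) h
  simpa [eval_finsetSum, monoCoeff] using this

theorem sum_monoCoeff (α d k : ℕ) : ∑ j ∈ Finset.range (k + 1), monoCoeff α d k j = 1 := by
  have := pow_eq_sum_monoCoeff α d k 1
  simpa [eval_one_jacobiPoly] using this.symm

theorem monoCoeff_le_one {α d k j : ℕ} (hj : j ≤ k) : monoCoeff α d k j ≤ 1 := by
  rw [← sum_monoCoeff α d k]
  exact Finset.single_le_sum (f := fun j => monoCoeff α d k j)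
    (fun i _ => monoCoeff_nonneg α d k i) (Finset.mem_range.2 (Nat.lt_succ_iff.2 hj))

theorem monoCoeff_self (α d k : ℕ) : monoCoeff α d k k = (jacobiLead α d k)⁻¹ := by
  rw [monoCoeff, wInt_mul_jacobiPoly, coeff_X_pow_self, mul_div_cancel_right₀ _
    (jacobiNorm_pos α d k).ne', one_div]
  rw [degree_X_pow]
  exact_mod_cast Nat.lt_succ_self k

/-- Used to force all other coefficients to zero once the top one tends to `1`. -/
theorem monoCoeff_le_of_lt {α d k j : ℕ} (hj : j < k) :
    monoCoeff α d k j ≤ 1 - monoCoeff α d k k := by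
  have h := sum_monoCoeff α d k
  rw [Finset.sum_range_succ] at h
  have := Finset.single_le_sum (f := fun j => monoCoeff α d k j)
    (fun i _ => monoCoeff_nonneg α d k i) (Finset.mem_range.2 hj)
  linarith

-- The inverse leading coefficient is a product of `k` factors `(α + 1 + i) / (α + 1 + k + d + i)`,
-- each tending to `1`.
open Filter Topology in
theorem tendsto_monoCoeff_self (d k : ℕ) :
    Tendsto (fun α => monoCoeff α d k k) atTop (𝓝 1) := by
  have h1 : ∀ α : ℕ, monoCoeff α d k k =
      ∏ i ∈ Finset.range k, ((α : ℝ) + 1 + i) / (α + 1 + (k + d) + i) := by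
    intro α
    rw [monoCoeff_self, jacobiLead, inv_div, Finset.prod_div_distrib]
    have h2 : ∀ a : ℕ, ((a + k).factorial : ℝ) =
        a.factorial * ∏ i ∈ Finset.range k, ((a : ℝ) + 1 + i) := by
      intro a
      rw [← Nat.factorial_mul_ascFactorial, Nat.ascFactorial_eq_prod_range]
      push_cast
      rfl
    have h3 : k + α + d + k = (α + (k + d)) + k := by ring
    rw [h3, h2 α, h2 (α + (k + d)), show k + α + d = α + (k + d) by ring]
    have h4 : (α.factorial : ℝ) ≠ 0 := by positivity
    have h5 : ((α + (k + d)).factorial : ℝ) ≠ 0 := by positivity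
    have h6 : ∏ i ∈ Finset.range k, (((α + (k + d) : ℕ) : ℝ) + 1 + i) =
        ∏ i ∈ Finset.range k, ((α : ℝ) + 1 + (k + d) + i) := by
      refine Finset.prod_congr rfl fun i _ => ?_
      push_cast
      ring
    rw [h6]
    have h7 : ∏ i ∈ Finset.range k, ((α : ℝ) + 1 + (k + d) + i) ≠ 0 :=
      (Finset.prod_pos fun i _ => by positivity).ne'
    field_simp
  simp only [h1]
  suffices h : Tendsto (fun α : ℕ =>
      ∏ i ∈ Finset.range k, ((α : ℝ) + 1 + i) / (α + 1 + (k + d) + i))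
      atTop (𝓝 (∏ i ∈ Finset.range k, (1 : ℝ))) by simpa using h
  refine tendsto_finsetProd _ fun i _ => ?_
  have h8 : ∀ α : ℕ, ((α : ℝ) + 1 + i) / (α + 1 + (k + d) + i) =
      1 - ((k : ℝ) + d) * ((α : ℝ) + (1 + (k + d) + i))⁻¹ := by
    intro α
    have : (α : ℝ) + 1 + (k + d) + i ≠ 0 := by positivity
    have : (α : ℝ) + (1 + (k + d) + i) ≠ 0 := by positivity
    field_simp
    ring
  simp only [h8]
  have h9 : Tendsto (fun α : ℕ => ((α : ℝ) + (1 + (k + d) + i))⁻¹) atTop (𝓝 0) :=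
    tendsto_inv_atTop_zero.comp
      (tendsto_atTop_add_const_right _ _ tendsto_natCast_atTop_atTop)
  simpa using (h9.const_mul ((k : ℝ) + d)).const_sub 1

/-! ### Bounds for Jacobi polynomials -/

/-- The polynomial-valued function `F` has coefficientwise derivative `F'` at `θ`. -/
def HasCoeffDerivAt (F : ℝ → ℝ[X]) (F' : ℝ[X]) (θ : ℝ) : Prop :=
  ∀ k, HasDerivAt (fun θ => (F θ).coeff k) (F'.coeff k) θ

theorem HasCoeffDerivAt.mul {F G : ℝ → ℝ[X]} {F' G' : ℝ[X]} {θ : ℝ} (hF : HasCoeffDerivAt F F' θ)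
    (hG : HasCoeffDerivAt G G' θ) :
    HasCoeffDerivAt (fun θ => F θ * G θ) (F' * G θ + F θ * G') θ := by
  intro k
  simp only [coeff_mul, coeff_add, ← Finset.sum_add_distrib]
  exact HasDerivAt.fun_sum fun i _ => (hF i.1).mul (hG i.2)

/-- The infinitesimal rotation on dehomogenized binary forms of degree `N`. -/
def rotDeriv (N : ℕ) (p : ℝ[X]) : ℝ[X] := (1 + X ^ 2) * derivative p - C (N : ℝ) * (X * p)

theorem rotDeriv_mul (M N : ℕ) (p q : ℝ[X]) :
    rotDeriv (M + N) (p * q) = rotDeriv M p * q + p * rotDeriv N q := by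
  simp only [rotDeriv, derivative_mul, Nat.cast_add, C_add]
  ring

theorem HasCoeffDerivAt.pow {F : ℝ → ℝ[X]} {N : ℕ} {θ : ℝ}
    (hF : HasCoeffDerivAt F (rotDeriv N (F θ)) θ) (m : ℕ) :
    HasCoeffDerivAt (fun θ => F θ ^ m) (rotDeriv (m * N) (F θ ^ m)) θ := by
  induction m with
  | zero =>
    intro k
    simpa [rotDeriv] using hasDerivAt_const θ ((1 : ℝ[X]).coeff k)
  | succ m ih =>
    have h := ih.mul hF
    rw [← rotDeriv_mul] at h
    simpa only [pow_succ, Nat.succ_mul] using h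

/-- The rotated monomial of bidegree `(m, n)`, dehomogenized. -/
def rotMonomial (m n : ℕ) (θ : ℝ) : ℝ[X] :=
  (C (Real.cos θ) * X + C (Real.sin θ)) ^ m * (C (-Real.sin θ) * X + C (Real.cos θ)) ^ n

theorem hasCoeffDerivAt_linear {a b : ℝ → ℝ} {a' b' θ : ℝ} (ha : HasDerivAt a a' θ)
    (hb : HasDerivAt b b' θ) :
    HasCoeffDerivAt (fun θ => C (a θ) * X + C (b θ)) (C a' * X + C b') θ := by
  intro k
  simp only [coeff_add, coeff_C_mul, coeff_C]
  refine (ha.mul_const _).add ?_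
  split_ifs
  · exact hb
  · exact hasDerivAt_const _ _

/-- Both linear factors solve the rotation equation in degree `1`, and `rotDeriv` obeys a Leibniz
rule in which degrees add. -/
theorem hasCoeffDerivAt_rotMonomial (m n : ℕ) (θ : ℝ) :
    HasCoeffDerivAt (rotMonomial m n) (rotDeriv (m + n) (rotMonomial m n θ)) θ := by
  have h1 : HasCoeffDerivAt (fun θ => C (Real.cos θ) * X + C (Real.sin θ))
      (rotDeriv 1 (C (Real.cos θ) * X + C (Real.sin θ))) θ := by
    convert! hasCoeffDerivAt_linear (Real.hasDerivAt_cos θ) (Real.hasDerivAt_sin θ) using 1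
    simp [rotDeriv]
    ring
  have h2 : HasCoeffDerivAt (fun θ => C (-Real.sin θ) * X + C (Real.cos θ))
      (rotDeriv 1 (C (-Real.sin θ) * X + C (Real.cos θ))) θ := by
    convert! hasCoeffDerivAt_linear (Real.hasDerivAt_sin θ).neg (Real.hasDerivAt_cos θ) using 1
    simp [rotDeriv]
    ring
  have h := (h1.pow m).mul (h2.pow n)
  rw [← rotDeriv_mul, mul_one, mul_one] at h
  exact h

theorem coeff_rotDeriv_zero (N : ℕ) (p : ℝ[X]) : (rotDeriv N p).coeff 0 = p.coeff 1 := by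
  simp [rotDeriv, mul_coeff_zero, coeff_derivative]

theorem coeff_rotDeriv_succ (N k : ℕ) (p : ℝ[X]) :
    (rotDeriv N p).coeff (k + 1) = (k + 2) * p.coeff (k + 2) - (N - k) * p.coeff k := by
  rw [rotDeriv, add_mul, one_mul, coeff_sub, coeff_add, coeff_C_mul, coeff_X_mul,
    coeff_derivative, sq, mul_assoc, coeff_X_mul]
  rcases k with _ | k
  · rw [coeff_X_mul_zero]
    push_cast
    ring_nf
  · rw [coeff_X_mul, coeff_derivative]
    push_cast
    ring_nf

/-- The rotation invariant square norm of a dehomogenized binary form of degree `N`. -/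
def apolarSq (N : ℕ) (p : ℝ[X]) : ℝ :=
  ∑ k ∈ Finset.range (N + 1), (k.factorial * (N - k).factorial : ℝ) * p.coeff k ^ 2

/-- The infinitesimal rotation is skew-symmetric for the factorial weights: the sum telescopes, with
boundary terms zero by convention at `0` and because `p.coeff (N + 1) = 0` at the other end. -/
theorem sum_coeff_mul_coeff_rotDeriv {N : ℕ} {p : ℝ[X]} (hp : p.natDegree ≤ N) :
    ∑ k ∈ Finset.range (N + 1), (k.factorial * (N - k).factorial : ℝ) *
      (2 * p.coeff k * (rotDeriv N p).coeff k) = 0 := by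
  set T : ℕ → ℝ := fun k => if k = 0 then 0 else
    2 * (k.factorial * (N + 1 - k).factorial : ℝ) * (p.coeff (k - 1) * p.coeff k) with hT
  have hstep : ∀ k ∈ Finset.range (N + 1), (k.factorial * (N - k).factorial : ℝ) *
      (2 * p.coeff k * (rotDeriv N p).coeff k) = T (k + 1) - T k := by
    intro k hk
    have hk' : k ≤ N := Nat.lt_succ_iff.1 (Finset.mem_range.1 hk)
    rcases k with _ | k
    · rw [coeff_rotDeriv_zero]
      simp [hT]
      ring
    · rw [coeff_rotDeriv_succ]
      have h1 : N + 1 - (k + 1) = (N - (k + 1)) + 1 := by omega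
      have h2 : N + 1 - (k + 1 + 1) = N - (k + 1) := by omega
      have h3 : ((N - (k + 1) : ℕ) : ℝ) = N - (k + 1) := by
        rw [Nat.cast_sub hk']
        push_cast
        ring
      simp only [hT, Nat.add_eq_zero_iff, one_ne_zero, and_false, if_false, h1, h2,
        Nat.add_sub_cancel, Nat.factorial_succ (k + 1), Nat.factorial_succ (N - (k + 1))]
      push_cast [h3]
      ring
  rw [Finset.sum_congr rfl hstep, Finset.sum_range_sub]
  have : p.coeff (N + 1) = 0 := coeff_eq_zero_of_natDegree_lt (by omega)
  simp [hT, this]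

theorem natDegree_rotMonomial_le (m n : ℕ) (θ : ℝ) : (rotMonomial m n θ).natDegree ≤ m + n := by
  have h : ∀ (a b : ℝ) (k : ℕ), ((C a * X + C b) ^ k).natDegree ≤ k := by
    intro a b k
    refine natDegree_pow_le.trans ?_
    have := natDegree_linear_le (a := a) (b := b)
    nlinarith
  exact natDegree_mul_le.trans (add_le_add (h _ _ _) (h _ _ _))

/-- The norm is constant in the angle, and at angle `0` the form is the monomial `X ^ m`. -/
theorem apolarSq_rotMonomial (m n : ℕ) (θ : ℝ) :
    apolarSq (m + n) (rotMonomial m n θ) = m.factorial * n.factorial := by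
  have hder : ∀ θ, HasDerivAt (fun θ => apolarSq (m + n) (rotMonomial m n θ)) 0 θ := by
    intro θ
    rw [← sum_coeff_mul_coeff_rotDeriv (natDegree_rotMonomial_le m n θ)]
    refine HasDerivAt.fun_sum fun k _ => ?_
    refine HasDerivAt.const_mul _ ?_
    simpa using (hasCoeffDerivAt_rotMonomial m n θ k).fun_pow 2
  have hconst := is_const_of_deriv_eq_zero (fun θ => (hder θ).differentiableAt)
    (fun θ => (hder θ).deriv) θ 0
  rw [hconst]
  have h0 : rotMonomial m n 0 = X ^ m := by simp [rotMonomial]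
  rw [h0, apolarSq, Finset.sum_eq_single m]
  · simp
  · intro b _ hb
    simp [coeff_X_pow, hb]
  · simp

theorem abs_coeff_rotMonomial_le (m n : ℕ) (θ : ℝ) : |(rotMonomial m n θ).coeff m| ≤ 1 := by
  have h := apolarSq_rotMonomial m n θ
  have h1 : (m.factorial * n.factorial : ℝ) * (rotMonomial m n θ).coeff m ^ 2 ≤
      m.factorial * n.factorial := by
    have h2 := Finset.single_le_sum (f := fun k => (k.factorial * (m + n - k).factorial : ℝ) *
      (rotMonomial m n θ).coeff k ^ 2) (fun i _ => by positivity)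
      (Finset.mem_range.2 (by omega : m < m + n + 1))
    rw [apolarSq] at h
    rwa [h, Nat.add_sub_cancel_left] at h2
  rw [← sq_le_one_iff_abs_le_one]
  have h2 : (0 : ℝ) < m.factorial * n.factorial := by positivity
  exact le_of_mul_le_mul_left (by simpa using h1) h2

/-- The radial Zernike polynomial, as a polynomial in the square of the radius and without its
monomial factor. -/
def zernikePoly (d n : ℕ) : ℝ[X] :=
  ∑ k ∈ Finset.range (n + 1),
    C ((-1) ^ k * (n + d).choose k * n.choose k : ℝ) * (X ^ (n - k) * (1 - X) ^ k)

theorem coeff_linear_pow (a b : ℝ) (m k : ℕ) :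
    ((C a * X + C b) ^ m).coeff k = a ^ k * b ^ (m - k) * m.choose k := by
  have h : (C a * X + C b) ^ m = ∑ i ∈ Finset.range (m + 1),
      C (a ^ i * b ^ (m - i) * m.choose i) * X ^ i := by
    rw [add_pow]
    refine Finset.sum_congr rfl fun i _ => ?_
    simp only [mul_pow, C_mul, C_pow, map_natCast]
    ring
  rw [h, finsetSum_coeff]
  simp only [coeff_C_mul, coeff_X_pow, mul_ite, mul_one, mul_zero]
  rw [Finset.sum_ite_eq]
  split_ifs with hk
  · rfl
  · rw [Nat.choose_eq_zero_of_lt (by simpa using hk)]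
    simp

/-- Both powers are expanded by the binomial theorem; `k` is the exponent of `X` taken from the
second factor. The radial Zernike polynomial at radius `cos θ` thus appears as a matrix coefficient
of a rotation, which bounds it. -/
theorem coeff_rotMonomial (d n : ℕ) (θ : ℝ) :
    (rotMonomial (n + d) n θ).coeff (n + d) =
      Real.cos θ ^ d * (zernikePoly d n).eval (Real.cos θ ^ 2) := by
  rw [rotMonomial, coeff_mul, ← Finset.Nat.sum_antidiagonal_swap,
    Finset.Nat.sum_antidiagonal_eq_sum_range_succ_mk, zernikePoly, eval_finsetSum, Finset.mul_sum]
  have hsub : Finset.range (n + 1) ⊆ Finset.range (n + d).succ :=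
    Finset.range_subset_range.2 (by omega)
  rw [← Finset.sum_subset hsub]
  · refine Finset.sum_congr rfl fun k hk => ?_
    have hk' : k ≤ n := Nat.lt_succ_iff.1 (Finset.mem_range.1 hk)
    obtain ⟨l, rfl⟩ := Nat.exists_eq_add_of_le hk'
    simp only [Prod.swap, coeff_linear_pow, eval_mul, eval_C, eval_pow, eval_X, eval_sub, eval_one]
    rw [← Real.sin_sq, show k + l + d - k = l + d by omega, show k + l - k = l by omega,
      show k + l + d - (l + d) = k by omega,
      ← Nat.choose_symm_of_eq_add (show k + l + d = (l + d) + k by ring), neg_pow]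
    ring
  · intro k _ hk
    have hk' : n < k := by simpa using hk
    simp only [Prod.swap, coeff_linear_pow]
    rw [Nat.choose_eq_zero_of_lt hk']
    simp

/-- Orthogonality again reduces to an alternating binomial sum, now of a polynomial of degree `j <
n`. -/
theorem zernikePoly_eq_jacobiPoly (d n : ℕ) : zernikePoly d n = jacobiPoly 0 d n := by
  refine eq_jacobiPoly_of_orthogonal ?_ ?_ fun j hj => ?_
  · have : (zernikePoly d n).natDegree ≤ n := by
      refine natDegree_sum_le_of_forall_le _ _ fun k hk => ?_
      have hk' : k ≤ n := Nat.lt_succ_iff.1 (Finset.mem_range.1 hk)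
      refine (natDegree_C_mul_le _ _).trans (natDegree_mul_le.trans ?_)
      have h1 := natDegree_one_sub_X_pow_le k
      have h2 := natDegree_X_pow_le (R := ℝ) (n - k)
      omega
    exact degree_le_natDegree.trans_lt (by exact_mod_cast Nat.lt_succ_iff.2 this)
  · rw [zernikePoly, eval_finsetSum, Finset.sum_range_succ']
    simp
  · set P : ℝ[X] := (ascPochhammer ℝ j).comp (C ((n + d : ℕ) + 1 : ℝ) - X) with hP
    have hdeg : P.natDegree < n := by
      rw [hP, natDegree_comp, ascPochhammer_natDegree, natDegree_sub, natDegree_X_sub_C]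
      omega
    have h := alternating_sum_choose_mul_eval hdeg
    rw [zernikePoly, Finset.mul_sum, map_sum]
    have hterm : ∀ k ∈ Finset.range (n + 1), wInt 0 d (X ^ j *
        (C ((-1) ^ k * (n + d).choose k * n.choose k : ℝ) * (X ^ (n - k) * (1 - X) ^ k))) =
        ((n + d).factorial / (d + j + n + 1).factorial : ℝ) *
          ((-1 : ℝ) ^ k * n.choose k * P.eval (k : ℝ)) := by
      intro k hk
      have hk' : k ≤ n := Nat.lt_succ_iff.1 (Finset.mem_range.1 hk)
      rw [mul_left_comm, wInt_C_mul, ← mul_assoc (X ^ j), ← pow_add,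
        wInt_X_pow_mul_one_sub_X_pow]
      have he : P.eval (k : ℝ) = ((n + d - k + j).factorial : ℝ) / (n + d - k).factorial := by
        have := poch_natCast_add_one (n + d - k) j
        rw [poch, Nat.cast_sub (by omega)] at this
        rw [hP, eval_comp, ← this]
        simp only [eval_sub, eval_X, eval_C]
        ring_nf
      rw [he, Nat.cast_choose ℝ (show k ≤ n + d by omega),
        show d + (j + (n - k)) = n + d - k + j by omega,
        show n + d - k + j + (0 + k) + 1 = d + j + n + 1 by omega, Nat.zero_add]
      have h1 : (k.factorial : ℝ) ≠ 0 := by positivity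
      have h2 : ((n + d - k).factorial : ℝ) ≠ 0 := by positivity
      field_simp
    rw [Finset.sum_congr rfl hterm, ← Finset.mul_sum, h, mul_zero]

theorem abs_pow_mul_jacobiPoly_zero_le (d n : ℕ) {r : ℝ} (h0 : 0 ≤ r) (h1 : r ≤ 1) :
    |r ^ d * (jacobiPoly 0 d n).eval (r ^ 2)| ≤ 1 := by
  have h := abs_coeff_rotMonomial_le (n + d) n (Real.arccos r)
  rwa [coeff_rotMonomial, Real.cos_arccos (by linarith) h1, zernikePoly_eq_jacobiPoly] at h

theorem jacobiPoly_eq_one_add (α d n : ℕ) :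
    ∃ q : ℝ[X], q.degree < n ∧ jacobiPoly α d n = 1 + (1 - X) * q := by
  refine ⟨∑ s ∈ Finset.range n, C (jacobiCoeff α d n (s + 1)) * (1 - X) ^ s, ?_, ?_⟩
  · rw [← mem_degreeLT]
    refine Submodule.sum_mem _ fun s hs => ?_
    rw [mem_degreeLT]
    have h : (C (jacobiCoeff α d n (s + 1)) * (1 - X) ^ s).natDegree ≤ s :=
      (natDegree_C_mul_le _ _).trans (natDegree_one_sub_X_pow_le s)
    refine degree_le_natDegree.trans_lt ?_
    exact_mod_cast h.trans_lt (Finset.mem_range.1 hs)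
  · rw [jacobiPoly, Finset.sum_range_succ', Finset.mul_sum]
    have h0 : jacobiCoeff α d n 0 = 1 := by
      have h3 : ((n + α + d).factorial : ℝ) ≠ 0 := by positivity
      have h4 : (α.factorial : ℝ) ≠ 0 := by positivity
      simp [jacobiCoeff, h3, h4]
    rw [h0, add_comm, pow_zero, C_1, mul_one]
    congr 1
    refine Finset.sum_congr rfl fun s _ => ?_
    ring

/-- Christoffel's formula: raising the parameter `α` by one gives a convex combination. -/
theorem jacobiPoly_succ_eq_sum (α d n : ℕ) :
    ∃ c : ℕ → ℝ, (∀ j, 0 ≤ c j) ∧ ∑ j ∈ Finset.range (n + 1), c j = 1 ∧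
      jacobiPoly (α + 1) d n = ∑ j ∈ Finset.range (n + 1), C (c j) * jacobiPoly α d j := by
  set κ := wInt α d (jacobiPoly (α + 1) d n) with hκ
  have hexp : jacobiPoly (α + 1) d n =
      ∑ j ∈ Finset.range (n + 1), C (κ / jacobiNorm α d j) * jacobiPoly α d j := by
    conv_lhs => rw [eq_sum_jacobiPoly α d (degree_jacobiPoly_lt (α + 1) d n)]
    refine Finset.sum_congr rfl fun j hj => ?_
    obtain ⟨q, hq, he⟩ := jacobiPoly_eq_one_add α d j
    have hq' : q.degree < n := hq.trans_le
      (by exact_mod_cast Nat.lt_succ_iff.1 (Finset.mem_range.1 hj))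
    -- Write the second factor as `1 + (1 - X) * q`. The factor `1 - X` raises the weight to `α +
    -- 1`, where `q`, of degree below `n`, is orthogonal to the first factor. Hence the value does
    -- not depend on `j`.
    have : wInt α d (jacobiPoly (α + 1) d n * jacobiPoly α d j) = κ := by
      rw [he, mul_add, mul_one, map_add, mul_left_comm, wInt_one_sub_X_mul, mul_comm _ q,
        wInt_mul_jacobiPoly_of_degree_lt hq', add_zero]
    rw [this]
  have hsum : ∑ j ∈ Finset.range (n + 1), κ / jacobiNorm α d j = 1 := by
    have h := congrArg (eval 1) hexp
    simpa [eval_finsetSum, eval_one_jacobiPoly] using h.symm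
  -- The coefficients all have the sign of `κ` and sum to `1`.
  have hκ0 : 0 ≤ κ := by
    by_contra hneg
    push Not at hneg
    have : ∑ j ∈ Finset.range (n + 1), κ / jacobiNorm α d j ≤ 0 :=
      Finset.sum_nonpos fun j _ => div_nonpos_of_nonpos_of_nonneg hneg.le (jacobiNorm_pos α d j).le
    linarith
  exact ⟨_, fun j => div_nonneg hκ0 (jacobiNorm_pos α d j).le, hsum, hexp⟩

/-- The case `α = 0` is the Zernike bound; a convex combination preserves it while `d` stays fixed.
-/
theorem abs_pow_mul_jacobiPoly_le (α d n : ℕ) {r : ℝ} (h0 : 0 ≤ r) (h1 : r ≤ 1) :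
    |r ^ d * (jacobiPoly α d n).eval (r ^ 2)| ≤ 1 := by
  induction α generalizing n with
  | zero => exact abs_pow_mul_jacobiPoly_zero_le d n h0 h1
  | succ α ih =>
    obtain ⟨c, hc0, hc1, hc⟩ := jacobiPoly_succ_eq_sum α d n
    rw [hc, eval_finsetSum, Finset.mul_sum, ← hc1]
    refine (Finset.abs_sum_le_sum_abs _ _).trans (Finset.sum_le_sum fun j _ => ?_)
    rw [eval_mul, eval_C, mul_left_comm, abs_mul, abs_of_nonneg (hc0 j)]
    exact mul_le_of_le_one_right (hc0 j) (ih j)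

end Jacobi

/-! ### Disc polynomials -/

/-- The distance of two natural numbers. -/
def gap (m n : ℕ) : ℕ := (m - n) + (n - m)

/-- The radial part of the disc polynomial. -/
def radial (a m n : ℕ) (r : ℝ) : ℝ :=
  r ^ gap m n * (jacobiPoly a (gap m n) (min m n)).eval (r ^ 2)

theorem abs_sub_eq_gap (m n : ℕ) : |(m : ℝ) - n| = (gap m n : ℝ) := by
  rcases le_total n m with h | h
  · rw [gap, Nat.sub_eq_zero_of_le h, add_zero, Nat.cast_sub h, abs_of_nonneg]
    exact sub_nonneg.2 (by exact_mod_cast h)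
  · rw [gap, Nat.sub_eq_zero_of_le h, zero_add, Nat.cast_sub h, abs_sub_comm, abs_of_nonneg]
    exact sub_nonneg.2 (by exact_mod_cast h)

theorem discPoly_natCast (a m n : ℕ) (z : ℂ) :
    discPoly a m n z = z ^ (m - n) * conj z ^ (n - m) *
      (((jacobiPoly a (gap m n) (min m n)).eval (‖z‖ ^ 2) : ℝ) : ℂ) := by
  rw [discPoly, abs_sub_eq_gap, jacobiR_eq_eval]

theorem discPoly_polar_natCast (a m n : ℕ) {r : ℝ} (θ : ℝ) (hr : 0 ≤ r) :
    discPoly a m n (r * Complex.exp (θ * Complex.I)) =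
      (radial a m n r : ℂ) * Complex.exp (((m - n : ℤ) : ℂ) * θ * Complex.I) := by
  rw [discPoly_polar _ _ _ _ _ hr, abs_sub_eq_gap, jacobiR_eq_eval, radial]
  have : ((m : ℤ) - (n : ℤ)).natAbs = gap m n := by
    unfold gap
    omega
  rw [this]
  push_cast
  ring

theorem abs_radial_le (a m n : ℕ) {r : ℝ} (h0 : 0 ≤ r) (h1 : r ≤ 1) : |radial a m n r| ≤ 1 :=
  abs_pow_mul_jacobiPoly_le _ _ _ h0 h1

theorem norm_discPoly_le (a m n : ℕ) {z : ℂ} (hz : ‖z‖ ≤ 1) : ‖discPoly a m n z‖ ≤ 1 := by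
  have h := abs_radial_le a m n (norm_nonneg z) hz
  rw [radial, abs_mul, abs_of_nonneg (by positivity)] at h
  rw [discPoly_natCast, norm_mul, norm_mul, norm_pow, norm_pow, RCLike.norm_conj, ← pow_add,
    Complex.norm_real]
  exact h

theorem discPoly_one (a m n : ℕ) : discPoly a m n 1 = 1 := by
  rw [discPoly_natCast]
  simp [eval_one_jacobiPoly]

/-- The coefficient of `discPoly a m n` in the expansion of the monomial
`z ^ (m+i) * conj z ^ (n+i)`. -/
def discWeight (a : ℕ) (p : ℕ × ℕ) (i : ℕ) : ℝ :=
  monoCoeff a (gap p.1 p.2) (min p.1 p.2 + i) (min p.1 p.2)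

/-- The angular factor is split off and the remaining power of `‖z‖ ^ 2` is expanded in Jacobi
polynomials. The sum is reflected so that `i` measures the drop in bidegree. -/
theorem monomial_eq_sum_discPoly (a m n : ℕ) (z : ℂ) :
    z ^ m * conj z ^ n = ∑ i ∈ Finset.range (min m n + 1),
      (discWeight a (m - i, n - i) i : ℂ) * discPoly a (m - i) (n - i) z := by
  have h1 : z ^ m * conj z ^ n = z ^ (m - n) * conj z ^ (n - m) *
      (((‖z‖ ^ 2) ^ min m n : ℝ) : ℂ) := by
    push_cast
    rw [← Complex.mul_conj', mul_pow, mul_mul_mul_comm, ← pow_add, ← pow_add,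
      show m - n + min m n = m by omega, show n - m + min m n = n by omega]
  rw [h1, pow_eq_sum_monoCoeff a (gap m n), ← Finset.sum_range_reflect, Complex.ofReal_sum,
    Finset.mul_sum]
  refine Finset.sum_congr rfl fun i hi => ?_
  have hi' : i ≤ min m n := Nat.lt_succ_iff.1 (Finset.mem_range.1 hi)
  have h2 : gap (m - i) (n - i) = gap m n := by unfold gap; omega
  have h3 : min (m - i) (n - i) = min m n - i := by omega
  rw [discPoly_natCast, discWeight, h2, h3, show m - i - (n - i) = m - n by omega,
    show n - i - (m - i) = n - m by omega, show min m n + 1 - 1 - i = min m n - i by omega,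
    show min m n - i + i = min m n by omega]
  push_cast
  ring

theorem discWeight_nonneg (a : ℕ) (p : ℕ × ℕ) (i : ℕ) : 0 ≤ discWeight a p i :=
  monoCoeff_nonneg _ _ _ _

theorem discWeight_le_one (a : ℕ) (p : ℕ × ℕ) (i : ℕ) : discWeight a p i ≤ 1 :=
  monoCoeff_le_one (by omega)

open Filter Topology in
theorem tendsto_discWeight (p : ℕ × ℕ) (i : ℕ) :
    Tendsto (fun a => discWeight a p i) atTop (𝓝 (if i = 0 then 1 else 0)) := by
  split_ifs with h
  · subst h
    exact tendsto_monoCoeff_self _ _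
  · have h1 := (tendsto_monoCoeff_self (gap p.1 p.2) (min p.1 p.2 + i)).const_sub 1
    rw [sub_self] at h1
    exact squeeze_zero (fun a => discWeight_nonneg a p i)
      (fun a => monoCoeff_le_of_lt (by omega)) h1

/-! ### Existence of the disc polynomial expansion -/

/-- The map that lists each power `z ^ m * conj z ^ n` together with the terms of its expansion. -/
def diagShift (x : (ℕ × ℕ) × ℕ) : (ℕ × ℕ) × ℕ := ((x.1.1 + x.2, x.1.2 + x.2), x.2)

theorem diagShift_injective : Function.Injective diagShift := by
  rintro ⟨⟨a, b⟩, i⟩ ⟨⟨c, d⟩, j⟩ h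
  simp only [diagShift, Prod.mk.injEq] at h ⊢
  omega

theorem mem_range_diagShift {x : (ℕ × ℕ) × ℕ} (h : x.2 ≤ min x.1.1 x.1.2) :
    x ∈ Set.range diagShift := by
  refine ⟨((x.1.1 - x.2, x.1.2 - x.2), x.2), ?_⟩
  rcases x with ⟨⟨a, b⟩, i⟩
  have h' : i ≤ min a b := h
  have h1 : a - i + i = a := by omega
  have h2 : b - i + i = b := by omega
  simp only [diagShift, h1, h2]

theorem sum_discWeight (a m n : ℕ) :
    ∑ i ∈ Finset.range (min m n + 1), discWeight a (m - i, n - i) i = 1 := by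
  have h := monomial_eq_sum_discPoly a m n 1
  simp only [one_pow, map_one, mul_one, discPoly_one] at h
  exact_mod_cast h.symm

/-- Regrouped by the monomial of origin, the weights sum to `1` for each monomial, so the total mass
is that of `c`. -/
theorem summable_discWeight_mul (a : ℕ) {c : ℕ × ℕ → ℝ} (hc0 : ∀ p, 0 ≤ c p)
    (hc : Summable c) : Summable fun x : (ℕ × ℕ) × ℕ =>
      discWeight a x.1 x.2 * c (x.1.1 + x.2, x.1.2 + x.2) := by
  set T : (ℕ × ℕ) × ℕ → ℝ := fun x => if x.2 ≤ min x.1.1 x.1.2 then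
    discWeight a (x.1.1 - x.2, x.1.2 - x.2) x.2 * c x.1 else 0 with hT
  have hcomp : (fun x : (ℕ × ℕ) × ℕ =>
      discWeight a x.1 x.2 * c (x.1.1 + x.2, x.1.2 + x.2)) = T ∘ diagShift := by
    funext x
    simp [hT, diagShift]
  have hfib : ∀ p : ℕ × ℕ, HasSum (fun i => T (p, i)) (c p) := by
    rintro ⟨m, n⟩
    have : c (m, n) = ∑ i ∈ Finset.range (min m n + 1), T ((m, n), i) := by
      rw [← one_mul (c (m, n)), ← sum_discWeight a m n, Finset.sum_mul]
      refine Finset.sum_congr rfl fun i hi => ?_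
      simp only [hT]
      rw [if_pos (Nat.lt_succ_iff.1 (Finset.mem_range.1 hi))]
    rw [this]
    refine hasSum_sum_of_ne_finset_zero fun i hi => if_neg fun h => hi ?_
    exact Finset.mem_range.2 (Nat.lt_succ_iff.2 h)
  have hT0 : 0 ≤ T := by
    intro x
    simp only [hT, Pi.zero_apply]
    split_ifs
    · exact mul_nonneg (discWeight_nonneg _ _ _) (hc0 _)
    · exact le_rfl
  rw [hcomp]
  refine Summable.comp_injective ?_ diagShift_injective
  rw [summable_prod_of_nonneg hT0]
  refine ⟨fun p => (hfib p).summable, ?_⟩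
  simpa only [(hfib _).tsum_eq] using hc

/-- Rearrangement of a double series into its diagonals. -/
theorem hasSum_diagShift {a : ℕ} {b : ℕ × ℕ → ℂ} {v : ℕ × ℕ → ℂ} {g : ℕ × ℕ → ℂ} {s : ℂ}
    (hg : ∀ m n, g (m, n) = ∑ i ∈ Finset.range (min m n + 1),
      (discWeight a (m - i, n - i) i : ℂ) * v (m - i, n - i))
    (hsum : HasSum (fun p => b p * g p) s)
    (hS : Summable fun x : (ℕ × ℕ) × ℕ =>
      (discWeight a x.1 x.2 : ℂ) * b (x.1.1 + x.2, x.1.2 + x.2) * v x.1) :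
    HasSum (fun x : (ℕ × ℕ) × ℕ =>
      (discWeight a x.1 x.2 : ℂ) * b (x.1.1 + x.2, x.1.2 + x.2) * v x.1) s := by
  set T : (ℕ × ℕ) × ℕ → ℂ := fun x => if x.2 ≤ min x.1.1 x.1.2 then
    (discWeight a (x.1.1 - x.2, x.1.2 - x.2) x.2 : ℂ) * b x.1 * v (x.1.1 - x.2, x.1.2 - x.2)
    else 0 with hT
  have hcomp : (fun x : (ℕ × ℕ) × ℕ =>
      (discWeight a x.1 x.2 : ℂ) * b (x.1.1 + x.2, x.1.2 + x.2) * v x.1) = T ∘ diagShift := by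
    funext x
    simp [hT, diagShift]
  have hzero : ∀ x ∉ Set.range diagShift, T x = 0 := fun x hx =>
    if_neg fun h => hx (mem_range_diagShift h)
  rw [hcomp] at hS ⊢
  rw [diagShift_injective.summable_iff hzero] at hS
  rw [diagShift_injective.hasSum_iff hzero]
  have hfib : ∀ p : ℕ × ℕ, HasSum (fun i => T (p, i)) (b p * g p) := by
    rintro ⟨m, n⟩
    rw [hg, Finset.mul_sum]
    have : ∑ i ∈ Finset.range (min m n + 1),
        b (m, n) * ((discWeight a (m - i, n - i) i : ℂ) * v (m - i, n - i)) =
        ∑ i ∈ Finset.range (min m n + 1), T ((m, n), i) := by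
      refine Finset.sum_congr rfl fun i hi => ?_
      simp only [hT]
      rw [if_pos (Nat.lt_succ_iff.1 (Finset.mem_range.1 hi))]
      ring
    rw [this]
    refine hasSum_sum_of_ne_finset_zero fun i hi => if_neg fun h => hi ?_
    exact Finset.mem_range.2 (Nat.lt_succ_iff.2 h)
  have h := hS.hasSum.prod_fiberwise hfib
  rw [← h.unique hsum]
  exact hS.hasSum

section Existence

variable {L : Type*} [Group L] [TopologicalSpace L] {f : ℂ → L → ℂ} {φ : ℕ → ℕ → L → ℂ}

/-- The coefficient functions of the disc polynomial expansion, in terms of those of the power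
expansion. -/
def discCoeff (a : ℕ) (φ : ℕ → ℕ → L → ℂ) (m n : ℕ) (u : L) : ℂ :=
  ∑' i : ℕ, (discWeight a (m, n) i : ℂ) * φ (m + i) (n + i) u

theorem IsPowerExpansion.norm_le (h : IsPowerExpansion f φ) (m n : ℕ) (u : L) :
    ‖φ m n u‖ ≤ (φ m n 1).re := IsPosDefKernel.norm_le (h.1 m n).2 u

theorem IsPowerExpansion.summable_re (h : IsPowerExpansion f φ) :
    Summable fun p : ℕ × ℕ => (φ p.1 p.2 1).re := (Complex.hasSum_re h.2.1.hasSum).summable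

theorem IsPowerExpansion.summable_discWeight (h : IsPowerExpansion f φ) (a : ℕ) :
    Summable fun x : (ℕ × ℕ) × ℕ =>
      discWeight a x.1 x.2 * (φ (x.1.1 + x.2) (x.1.2 + x.2) 1).re :=
  summable_discWeight_mul a (c := fun p => (φ p.1 p.2 1).re)
    (fun p => IsPosDefKernel.re_one_nonneg (h.1 p.1 p.2).2) h.summable_re

theorem IsPowerExpansion.norm_discWeight_mul_le (h : IsPowerExpansion f φ) (a : ℕ) (p : ℕ × ℕ)
    (i : ℕ) (u : L) : ‖(discWeight a p i : ℂ) * φ (p.1 + i) (p.2 + i) u‖ ≤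
      discWeight a p i * (φ (p.1 + i) (p.2 + i) 1).re := by
  rw [norm_mul, Complex.norm_real, Real.norm_eq_abs, abs_of_nonneg (discWeight_nonneg a p i)]
  exact mul_le_mul_of_nonneg_left (h.norm_le _ _ u) (discWeight_nonneg a p i)

theorem IsPowerExpansion.summable_discCoeff (h : IsPowerExpansion f φ) (a : ℕ) (p : ℕ × ℕ)
    (u : L) : Summable fun i => (discWeight a p i : ℂ) * φ (p.1 + i) (p.2 + i) u :=
  Summable.of_norm_bounded ((h.summable_discWeight a).prod_factor p)
    fun i => h.norm_discWeight_mul_le a p i u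

theorem IsPowerExpansion.isPosDefFun_discCoeff (h : IsPowerExpansion f φ) (a m n : ℕ) :
    IsPosDefFun (discCoeff a φ m n) := by
  constructor
  · exact continuous_tsum (fun i => continuous_const.mul (h.1 _ _).1)
      ((h.summable_discWeight a).prod_factor (m, n))
      fun i u => h.norm_discWeight_mul_le a (m, n) i u
  · refine isPosDefKernel_tsum (fun i => ?_) fun x y => h.summable_discCoeff a (m, n) _
    refine IsPosDefKernel.const_mul (h.1 _ _).2 ?_
    exact_mod_cast discWeight_nonneg a (m, n) i

/-- Each monomial is expanded in disc polynomials and the sums are interchanged; absolute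
convergence holds because disc polynomials are bounded by `1`. -/
theorem IsPowerExpansion.isDiscExpansion (h : IsPowerExpansion f φ) (a : ℕ) :
    IsDiscExpansion (a + 2) f (discCoeff a φ) := by
  have ha : (((a + 2 : ℕ) : ℝ) - 2) = a := by push_cast; ring
  have hexp : ∀ z ∈ Metric.closedBall (0 : ℂ) 1, ∀ u : L,
      HasSum (fun p : ℕ × ℕ => discCoeff a φ p.1 p.2 u * discPoly a p.1 p.2 z) (f z u) := by
    intro z hz u
    have hz' : ‖z‖ ≤ 1 := by simpa using hz
    have hS : Summable fun x : (ℕ × ℕ) × ℕ => (discWeight a x.1 x.2 : ℂ) *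
        φ (x.1.1 + x.2) (x.1.2 + x.2) u * discPoly a x.1.1 x.1.2 z := by
      refine Summable.of_norm_bounded (h.summable_discWeight a) fun x => ?_
      rw [norm_mul]
      exact (mul_le_of_le_one_right (norm_nonneg _) (norm_discPoly_le a _ _ hz')).trans
        (h.norm_discWeight_mul_le a x.1 x.2 u)
    have h1 := hasSum_diagShift (b := fun p => φ p.1 p.2 u)
      (v := fun p => discPoly a p.1 p.2 z) (g := fun p => z ^ p.1 * conj z ^ p.2)
      (fun m n => monomial_eq_sum_discPoly a m n z) (h.2.2 z hz u) hS
    refine h1.prod_fiberwise fun p => ?_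
    have h2 : HasSum (fun i => (discWeight a p i : ℂ) * φ (p.1 + i) (p.2 + i) u)
        (discCoeff a φ p.1 p.2 u) := (h.summable_discCoeff a p u).hasSum
    have h3 := h2.mul_right (discPoly a p.1 p.2 z)
    exact h3
  refine ⟨fun m n => h.isPosDefFun_discCoeff a m n, ?_, ?_⟩
  -- Disc polynomials equal `1` at `z = 1`, so the expansion at `(1, 1)` is the required series.
  · have := (hexp 1 (by simp) 1).summable
    simpa only [discPoly_one, mul_one] using this
  · rw [ha]
    exact hexp

theorem IsPowerExpansion.norm_discCoeff_sub_le (h : IsPowerExpansion f φ) (a m n : ℕ) (u : L) :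
    ‖discCoeff a φ m n u - φ m n u‖ ≤
      ∑' i : ℕ, |discWeight a (m, n) i - if i = 0 then 1 else 0| * (φ (m + i) (n + i) 1).re := by
  have h1 : HasSum (fun i : ℕ => ((if i = 0 then 1 else 0 : ℝ) : ℂ) * φ (m + i) (n + i) u)
      (φ m n u) := by
    convert hasSum_ite_eq 0 (φ m n u) using 2 with i
    split_ifs with hi
    · simp [hi]
    · simp
  have h2 := (h.summable_discCoeff a (m, n) u).hasSum.sub h1
  have h0 : ∀ i, 0 ≤ (φ (m + i) (n + i) 1).re := fun i =>
    IsPosDefKernel.re_one_nonneg (h.1 _ _).2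
  refine h2.norm_le_of_bounded (Summable.hasSum ?_) fun i => ?_
  · have hs := (h.summable_discWeight a).prod_factor (m, n)
    have h3 : Summable fun i : ℕ => (if i = 0 then 1 else 0 : ℝ) * (φ (m + i) (n + i) 1).re :=
      summable_of_ne_finset_zero (s := {0}) fun i hi => by simp [Finset.notMem_singleton.1 hi]
    refine (hs.add h3).of_nonneg_of_le (fun i => mul_nonneg (abs_nonneg _) (h0 i)) fun i => ?_
    rw [← add_mul]
    refine mul_le_mul_of_nonneg_right ?_ (h0 i)
    refine (abs_sub _ _).trans ?_
    rw [abs_of_nonneg (discWeight_nonneg a (m, n) i), abs_of_nonneg]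
    split_ifs <;> norm_num
  · rw [← sub_mul, ← Complex.ofReal_sub, norm_mul, Complex.norm_real, Real.norm_eq_abs]
    exact mul_le_mul_of_nonneg_left (h.norm_le _ _ u) (abs_nonneg _)

-- Dominated convergence in `i`, with majorant `Re φ (m + i) (n + i) 1`. The bound is independent of
-- `u`, so the convergence is uniform on the whole group.
open Filter Topology in
theorem IsPowerExpansion.tendstoUniformly_discCoeff (h : IsPowerExpansion f φ) (m n : ℕ) :
    TendstoUniformly (fun a => discCoeff a φ m n) (φ m n) atTop := by
  have h0 : ∀ i, 0 ≤ (φ (m + i) (n + i) 1).re := fun i =>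
    IsPosDefKernel.re_one_nonneg (h.1 _ _).2
  have hs : Summable fun i => (φ (m + i) (n + i) 1).re := by
    have hinj : Function.Injective fun i : ℕ => (m + i, n + i) := by
      intro i j hij
      simpa using hij
    exact h.summable_re.comp_injective hinj
  have hlim := tendsto_tsum_of_dominated_convergence (𝓕 := atTop)
    (f := fun (a i : ℕ) => |discWeight a (m, n) i - if i = 0 then 1 else 0| *
      (φ (m + i) (n + i) 1).re) (g := fun _ => (0 : ℝ)) hs (fun i => ?_)
    (.of_forall fun a i => ?_)
  · rw [tsum_zero] at hlim
    rw [Metric.tendstoUniformly_iff]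
    intro ε hε
    filter_upwards [hlim.eventually_lt_const hε] with a ha u
    rw [dist_comm, dist_eq_norm]
    exact (h.norm_discCoeff_sub_le a m n u).trans_lt ha
  · have h1 := ((tendsto_discWeight (m, n) i).sub_const (if i = 0 then 1 else 0)).abs
    rw [sub_self, abs_zero] at h1
    simpa using h1.mul_const (φ (m + i) (n + i) 1).re
  · rw [Real.norm_eq_abs, abs_mul, abs_abs, abs_of_nonneg (h0 i)]
    refine mul_le_of_le_one_left (h0 i) ?_
    have h1 := discWeight_nonneg a (m, n) i
    have h2 := discWeight_le_one a (m, n) i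
    rw [abs_le]
    split_ifs <;> constructor <;> linarith

end Existence

/-! ### Uniqueness of the disc polynomial expansion -/

theorem integral_exp_int_mul (j : ℤ) :
    ∫ θ in (0 : ℝ)..(2 * Real.pi), Complex.exp ((j : ℂ) * θ * Complex.I) =
      if j = 0 then 2 * Real.pi else 0 := by
  split_ifs with h
  · simp [h]
  · have hc : (j : ℂ) * Complex.I ≠ 0 := mul_ne_zero (by exact_mod_cast h) Complex.I_ne_zero
    have h1 := integral_exp_mul_complex (a := 0) (b := 2 * Real.pi) hc
    have h2 : (j : ℂ) * Complex.I * ((2 * Real.pi : ℝ) : ℂ) = j * (2 * Real.pi * Complex.I) := by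
      push_cast
      ring
    rw [h2, Complex.exp_int_mul_two_pi_mul_I] at h1
    simp only [Complex.ofReal_zero, mul_zero, Complex.exp_zero, sub_self, zero_div] at h1
    rw [Complex.ofReal_zero, ← h1]
    congr 1
    ext θ
    ring_nf

theorem hasSum_integral_of_norm_le {ι : Type*} [Countable ι] {F : ι → ℝ → ℂ} {g : ℝ → ℂ}
    {a b : ℝ} (hab : a ≤ b) {B : ι → ℝ} (hB : Summable B) (hF : ∀ i, Continuous (F i))
    (hFB : ∀ i, ∀ t ∈ Set.Icc a b, ‖F i t‖ ≤ B i)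
    (hg : ∀ t ∈ Set.Icc a b, HasSum (fun i => F i t) (g t)) :
    HasSum (fun i => ∫ t in a..b, F i t) (∫ t in a..b, g t) := by
  have hsub : Set.uIoc a b ⊆ Set.Icc a b := by
    rw [Set.uIoc_of_le hab]
    exact Set.Ioc_subset_Icc_self
  exact intervalIntegral.hasSum_integral_of_dominated_convergence (fun i _ => B i)
    (fun i => (hF i).aestronglyMeasurable)
    (fun i => .of_forall fun t ht => hFB i t (hsub ht))
    (.of_forall fun t _ => hB) (by simp)
    (.of_forall fun t ht => hg t (hsub ht))

theorem continuous_radial (a m n : ℕ) : Continuous (radial a m n) := by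
  unfold radial
  fun_prop

/-- Integration against `exp (-i k θ)` over the circle of radius `r` selects the terms with `p.1 -
p.2 = k`. -/
theorem hasSum_radial {a : ℕ} {b : ℕ × ℕ → ℂ} (hb : Summable fun p => ‖b p‖)
    (h : ∀ z ∈ Metric.closedBall (0 : ℂ) 1,
      HasSum (fun p : ℕ × ℕ => b p * discPoly a p.1 p.2 z) 0) (k : ℤ) {r : ℝ} (hr0 : 0 ≤ r)
    (hr1 : r ≤ 1) :
    HasSum (fun p : ℕ × ℕ => if (p.1 : ℤ) - p.2 = k then b p * (radial a p.1 p.2 r : ℂ) else 0)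
      0 := by
  have hz : ∀ θ : ℝ, (r : ℂ) * Complex.exp (θ * Complex.I) ∈ Metric.closedBall (0 : ℂ) 1 := by
    intro θ
    rw [mem_closedBall_zero_iff, norm_mul, Complex.norm_exp_ofReal_mul_I, Complex.norm_real,
      Real.norm_eq_abs, abs_of_nonneg hr0, mul_one]
    exact hr1
  have hexp : ∀ (j : ℤ) (θ : ℝ), ‖Complex.exp ((j : ℂ) * θ * Complex.I)‖ = 1 := by
    intro j θ
    have := Complex.norm_exp_ofReal_mul_I ((j : ℝ) * θ)
    push_cast at this
    exact this
  have h1 := hasSum_integral_of_norm_le (a := 0) (b := 2 * Real.pi) (g := fun _ => 0)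
    (F := fun (p : ℕ × ℕ) θ => b p * (radial a p.1 p.2 r : ℂ) *
      Complex.exp (((((p.1 : ℤ) - p.2 - k : ℤ)) : ℂ) * θ * Complex.I))
    Real.two_pi_pos.le hb (fun p => by fun_prop) (fun p θ _ => ?_) (fun θ _ => ?_)
  · rw [intervalIntegral.integral_zero] at h1
    have h2 := h1.mul_left ((2 * Real.pi : ℝ) : ℂ)⁻¹
    rw [mul_zero] at h2
    refine h2.congr_fun fun p => ?_
    rw [intervalIntegral.integral_const_mul, integral_exp_int_mul]
    have hpi : ((2 * Real.pi : ℝ) : ℂ) ≠ 0 := by exact_mod_cast Real.two_pi_pos.ne'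
    simp only [sub_eq_zero]
    split_ifs
    · push_cast at hpi ⊢
      rw [mul_left_comm, inv_mul_cancel₀ hpi, mul_one]
    · simp
  · rw [norm_mul, norm_mul, hexp, mul_one, Complex.norm_real]
    exact mul_le_of_le_one_right (norm_nonneg _) (abs_radial_le a p.1 p.2 hr0 hr1)
  · have h3 := (h _ (hz θ)).mul_right (Complex.exp ((-k : ℂ) * θ * Complex.I))
    rw [zero_mul] at h3
    refine h3.congr_fun fun p => ?_
    have he : Complex.exp ((((p.1 : ℤ) - p.2 - k : ℤ) : ℂ) * θ * Complex.I) =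
        Complex.exp ((((p.1 : ℤ) - p.2 : ℤ) : ℂ) * θ * Complex.I) *
          Complex.exp ((-k : ℂ) * θ * Complex.I) := by
      rw [← Complex.exp_add]
      congr 1
      push_cast
      ring
    rw [discPoly_polar_natCast a _ _ θ hr0, he]
    ring

theorem integral_radial_mul_radial {a m n m' n' : ℕ} (h : (m : ℤ) - n = m' - n') :
    ∫ t in (0 : ℝ)..1, radial a m n (Real.sqrt t) * radial a m' n' (Real.sqrt t) * (1 - t) ^ a =
      wInt a (gap m n) (jacobiPoly a (gap m n) (min m n) * jacobiPoly a (gap m n) (min m' n')) := by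
  have hgap : gap m' n' = gap m n := by
    unfold gap
    omega
  rw [wInt_apply]
  refine intervalIntegral.integral_congr fun t ht => ?_
  rw [Set.uIcc_of_le zero_le_one] at ht
  simp only [radial, hgap, Real.sq_sqrt ht.1, Polynomial.eval_mul]
  have h2 : Real.sqrt t ^ gap m n * Real.sqrt t ^ gap m n = t ^ gap m n := by
    rw [← mul_pow, Real.mul_self_sqrt ht.1]
  linear_combination (Polynomial.eval t (jacobiPoly a (gap m n) (min m n)) *
    Polynomial.eval t (jacobiPoly a (gap m n) (min m' n')) * (1 - t) ^ a) * h2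

/-- Among pairs with a fixed difference, `min` determines the pair. Pairing with one radial part,
with `t = r ^ 2` as variable, therefore isolates a single coefficient times a positive Jacobi norm.
-/
theorem eq_zero_of_hasSum_discPoly {a : ℕ} {b : ℕ × ℕ → ℂ} (hb : Summable fun p => ‖b p‖)
    (h : ∀ z ∈ Metric.closedBall (0 : ℂ) 1,
      HasSum (fun p : ℕ × ℕ => b p * discPoly a p.1 p.2 z) 0) (p : ℕ × ℕ) : b p = 0 := by
  obtain ⟨m, n⟩ := p
  have h1 := hasSum_integral_of_norm_le (a := 0) (b := 1) (g := fun _ => 0)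
    (F := fun (p : ℕ × ℕ) t => if (p.1 : ℤ) - p.2 = m - n then b p *
      ((radial a p.1 p.2 (Real.sqrt t) * radial a m n (Real.sqrt t) * (1 - t) ^ a : ℝ) : ℂ) else 0)
    zero_le_one hb (fun p => ?_) (fun p t ht => ?_) (fun t ht => ?_)
  · rw [intervalIntegral.integral_zero] at h1
    have h2 : ∀ p : ℕ × ℕ, p ≠ (m, n) → (∫ t in (0 : ℝ)..1,
        (if (p.1 : ℤ) - p.2 = m - n then b p * ((radial a p.1 p.2 (Real.sqrt t) *
          radial a m n (Real.sqrt t) * (1 - t) ^ a : ℝ) : ℂ) else 0)) = 0 := by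
      rintro ⟨m', n'⟩ hp
      split_ifs with heq
      · have hne : min m' n' ≠ min m n := by
          intro hmin
          apply hp
          simp only [Prod.mk.injEq]
          simp only at heq
          omega
        rw [intervalIntegral.integral_const_mul, intervalIntegral.integral_ofReal,
          integral_radial_mul_radial heq, wInt_jacobiPoly_mul_of_ne hne]
        simp
      · simp
    have h3 := h1.unique (hasSum_single (m, n) h2)
    simp only [if_true] at h3
    rw [intervalIntegral.integral_const_mul, intervalIntegral.integral_ofReal,
      integral_radial_mul_radial rfl] at h3
    have h4 : ((wInt a (gap m n) (jacobiPoly a (gap m n) (min m n) *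
        jacobiPoly a (gap m n) (min m n)) : ℝ) : ℂ) ≠ 0 := by
      exact_mod_cast (jacobiNorm_pos a (gap m n) (min m n)).ne'
    exact (mul_eq_zero.1 h3.symm).resolve_right h4
  · have h2 := continuous_radial a p.1 p.2
    have h3 := continuous_radial a m n
    split_ifs <;> fun_prop
  · split_ifs
    · rw [norm_mul, Complex.norm_real, Real.norm_eq_abs, abs_mul, abs_mul]
      refine mul_le_of_le_one_right (norm_nonneg _) ?_
      have hs1 : Real.sqrt t ≤ 1 := Real.sqrt_le_one.2 ht.2
      have h2 := abs_radial_le a p.1 p.2 (Real.sqrt_nonneg t) hs1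
      have h3 := abs_radial_le a m n (Real.sqrt_nonneg t) hs1
      have h4 : |(1 - t) ^ a| ≤ 1 := by
        rw [abs_of_nonneg (pow_nonneg (by linarith [ht.2]) _)]
        exact pow_le_one₀ (by linarith [ht.2]) (by linarith [ht.1])
      exact mul_le_one₀ (mul_le_one₀ h2 (abs_nonneg _) h3) (abs_nonneg _) h4
    · simp
  · have h2 := (hasSum_radial hb h ((m : ℤ) - n) (Real.sqrt_nonneg t)
      (Real.sqrt_le_one.2 ht.2)).mul_right
        ((radial a m n (Real.sqrt t) * (1 - t) ^ a : ℝ) : ℂ)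
    rw [zero_mul] at h2
    refine h2.congr_fun fun p => ?_
    split_ifs
    · push_cast
      ring
    · simp

section Group

variable {L : Type*} [Group L] [TopologicalSpace L] {f : ℂ → L → ℂ}

theorem IsDiscExpansion.summable_norm {q : ℕ} {Φ : ℕ → ℕ → L → ℂ} (h : IsDiscExpansion q f Φ)
    (u : L) : Summable fun p : ℕ × ℕ => ‖Φ p.1 p.2 u‖ :=
  (Complex.hasSum_re h.2.1.hasSum).summable.of_nonneg_of_le (fun _ => norm_nonneg _)
    fun p => IsPosDefKernel.norm_le (h.1 p.1 p.2).2 u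

theorem IsDiscExpansion.unique {q : ℕ} (hq : 2 ≤ q) {Φ Ψ : ℕ → ℕ → L → ℂ}
    (hΦ : IsDiscExpansion q f Φ) (hΨ : IsDiscExpansion q f Ψ) : Φ = Ψ := by
  obtain ⟨a, rfl⟩ := Nat.exists_eq_add_of_le' hq
  have ha : (((a + 2 : ℕ) : ℝ) - 2) = a := by push_cast; ring
  funext m n u
  have h := eq_zero_of_hasSum_discPoly (a := a) (b := fun p => Φ p.1 p.2 u - Ψ p.1 p.2 u)
    (((hΦ.summable_norm u).add (hΨ.summable_norm u)).of_nonneg_of_le (fun _ => norm_nonneg _)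
      fun p => norm_sub_le _ _) (fun z hz => ?_) (m, n)
  · exact sub_eq_zero.1 h
  · have h1 := (hΦ.2.2 z hz u).sub (hΨ.2.2 z hz u)
    rw [sub_self, ha] at h1
    simpa only [sub_mul] using h1

end Group

end PDSphere

end

theorem theorem1p6 {L : Type*} [Group L] [TopologicalSpace L] [IsTopologicalGroup L]
    [LocallyCompactSpace L] (f : ℂ → L → ℂ) (hf : PDSphere.MemPSphereInfty f) :
    -- existence and uniqueness of the coefficient functions
    (∀ q : ℕ, 2 ≤ q → ∃! φ : ℕ → ℕ → L → ℂ, PDSphere.IsDiscExpansion q f φ) ∧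
    (∃! φ : ℕ → ℕ → L → ℂ, PDSphere.IsPowerExpansion f φ) ∧
    -- the derivatives exist
    (∀ u : L, ContDiffOn ℝ ∞ (fun z => f z u) (Metric.ball (0 : ℂ) 1)) ∧
    -- the limits; `Φ q` is the family with upper index `q - 2`
    (∀ (Φ : ℕ → ℕ → ℕ → L → ℂ) (φ : ℕ → ℕ → L → ℂ),
      (∀ q : ℕ, 2 ≤ q → PDSphere.IsDiscExpansion q f (Φ q)) →
      PDSphere.IsPowerExpansion f φ →
      ∀ m n : ℕ,
        (∀ u : L, φ m n u = 1 / ((m.factorial : ℂ) * (n.factorial : ℂ)) *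
          (PDSphere.dz^[m] (PDSphere.dzbar^[n] (fun z => f z u))) 0) ∧
        ∀ K : Set L, IsCompact K →
          TendstoUniformlyOn (fun q : ℕ => Φ q m n) (φ m n) Filter.atTop K) := by
  obtain ⟨ψ, hψ⟩ := PDSphere.exists_isPowerExpansion hf
  refine ⟨fun q hq => ?_, ⟨ψ, hψ, fun φ hφ => ?_⟩, fun u => ?_, fun Φ φ hΦ hφ m n =>
    ⟨fun u => hφ.eq_iterate m n u, fun K _ => ?_⟩⟩
  · obtain ⟨a, rfl⟩ := Nat.exists_eq_add_of_le' hq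
    exact ⟨_, hψ.isDiscExpansion a, fun Ψ hΨ => hΨ.unique hq (hψ.isDiscExpansion a)⟩
  · funext m n u
    rw [hφ.eq_iterate, hψ.eq_iterate]
  · exact (PDSphere.contDiffOn_conjSeries (hψ.polyGrowth u)).congr (hψ.eqOn u)
  -- Convergence is in fact uniform on `L`. For `q ≥ 2` uniqueness identifies `Φ q` with the
  -- coefficients built from `φ` at parameter `q - 2`.
  · refine TendstoUniformly.tendstoUniformlyOn ?_
    have h1 := hφ.tendstoUniformly_discCoeff m n
    rw [Metric.tendstoUniformly_iff] at h1 ⊢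
    intro ε hε
    filter_upwards [(Filter.tendsto_sub_atTop_nat 2).eventually (h1 ε hε),
      Filter.eventually_ge_atTop 2] with q hq1 hq2 u
    have h2 := (hΦ q hq2).unique hq2 (by
      have := hφ.isDiscExpansion (q - 2)
      rwa [Nat.sub_add_cancel hq2] at this)
    rw [h2]
    exact hq1 u
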